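/- Let $\Lambda$ be the ring $\mathbb Z[v^{\pm1},s^{\pm1}]$ with all $\{r\}=s^r-s^{-r}$, $r\ge 1$, inverted, and put $z=s-s^{-1}$, $\delta=(v^{-1}-v)/(s-s^{-1})$. Let $\mathcal C$ be the Homfly skein of the annulus: $\Lambda$-linear combinations of oriented link diagrams in the annulus up to planar isotopy and Reidemeister moves II and III, modulo the local relations (positive crossing) $-$ (negative crossing) $=(s-s^{-1})\,$(smoothing), a positive curl equals $v^{-1}$ times a plain strand, a negative curl equals $v$ times a plain strand, and deleting a trivial circle multiplies by $\delta$. It is an algebra, with the product given by placing one annulus outside another. Let $H_m$ be the Homfly skein of the rectangle with $m$ input and $m$ output points (the Hecke algebra, with $\sigma_i-\sigma_i^{-1}=z$ for the positive elementary braids $\sigma_i$); closing diagrams in the annulus gives a $\Lambda$-linear map $H_m\to\mathcal C$. Let $A_m$ be the closure of the braid $\sigma_{m-1}\cdots\sigma_2\sigma_1$, let $\overline A_m$ be its mirror image, the closure of $\sigma_{m-1}^{-1}\cdots\sigma_2^{-1}\sigma_1^{-1}$, let $A_{i,j}$ be the closure of the $(i+j+1)$-braid $\sigma_{i+j}\cdots\sigma_{j+1}\,\sigma_j^{-1}\cdots\sigma_1^{-1}$,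 and let $$X_m=\sum_{j=0}^{m-1}A_{m-1-j,\,j}.$$ Let $h_m\in\mathcal C$ be the closure of $\alpha_m^{-1}a_m$, where $a_m=\sum_{\pi\in S_m}s^{l(\pi)}\omega_\pi\in H_m$ with $\omega_\pi$ the positive permutation braid of $\pi$, and $\alpha_m$ is the invertible scalar with $a_m a_m=\alpha_m a_m$. Let $P_m\in\mathcal C$ be the power sums, defined by Newton's relation $\ln\bigl(1+\sum_{n\ge1}h_nt^n\bigr)=\sum_{m\ge1}\frac{P_m}{m}t^m$, that is, $m\,h_m=\sum_{r=1}^{m}P_r\,h_{m-r}$ with $h_0=1$. Let $\varphi,\overline\varphi:\mathcal C\to\mathcal C$ be the meridian maps, the linear maps induced by adding to a diagram a meridian circle around all of the annulus, where for $\varphi$ the meridian has linking number $+1$ with the core of the annulus (oriented as the strands of $A_m$), and for $\overline\varphi$ its orientation is reversed. For $Q\in\mathcal C$ set $\Delta_\varphi(Q)=\varphi(Q)-\delta Q$ and $\Delta_{\overline\varphi}(Q)=\overline\varphi(Q)-\delta Q$. Theorem. For every $m\ge1$, $$(s-s^{-1})\,X_m=v\,\Delta_\varphi(\overline A_m)=-v^{-1}\,\Delta_{\overline\varphi}(A_m),$$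 and hence $$\{m\}\,P_m=v\,\Delta_\varphi(\overline A_m)=-v^{-1}\,\Delta_{\overline\varphi}(A_m).$$ -/

import Mathlib

namespace HomflySkein

noncomputable section

/-! ### The coefficient ring -/

/-- The multiplicative set generated by `v`, `s` (the variables `X 0`, `X 1`) and all
`s ^ (2 * r) - 1 = s ^ r * (s ^ r - s ^ (-r))` with `r ≥ 1`. -/
def denominators : Submonoid (MvPolynomial (Fin 2) ℤ) :=
  Submonoid.closure ({MvPolynomial.X 0, MvPolynomial.X 1} ∪
    {p | ∃ r : ℕ, 1 ≤ r ∧ p = MvPolynomial.X 1 ^ (2 * r) - 1})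

/-- The ring `Λ`: Laurent polynomials over `ℤ` in `v` and `s`, with all `s ^ r - s ^ (-r)`,
`r ≥ 1`, inverted. -/
def Scalar : Type := Localization denominators

instance : CommRing Scalar := inferInstanceAs (CommRing (Localization denominators))

instance : Algebra (MvPolynomial (Fin 2) ℤ) Scalar :=
  inferInstanceAs (Algebra (MvPolynomial (Fin 2) ℤ) (Localization denominators))

instance : IsLocalization denominators Scalar :=
  inferInstanceAs (IsLocalization denominators (Localization denominators))

theorem X_zero_mem : (MvPolynomial.X 0 : MvPolynomial (Fin 2) ℤ) ∈ denominators :=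
  Submonoid.subset_closure (by simp)

theorem X_one_mem : (MvPolynomial.X 1 : MvPolynomial (Fin 2) ℤ) ∈ denominators :=
  Submonoid.subset_closure (by simp)

def v : Scalarˣ := (IsLocalization.map_units Scalar (⟨_, X_zero_mem⟩ : denominators)).unit

def s : Scalarˣ := (IsLocalization.map_units Scalar (⟨_, X_one_mem⟩ : denominators)).unit

/-- `{r} = s ^ r - s ^ (-r)`. -/
def brace (r : ℕ) : Scalar := ((s ^ r : Scalarˣ) : Scalar) - (((s ^ r)⁻¹ : Scalarˣ) : Scalar)

theorem isUnit_brace {r : ℕ} (hr : 1 ≤ r) : IsUnit (brace r) := by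
  have h : (MvPolynomial.X 1 ^ (2 * r) - 1 : MvPolynomial (Fin 2) ℤ) ∈ denominators :=
    Submonoid.subset_closure (Or.inr ⟨r, hr, rfl⟩)
  have h1 := IsLocalization.map_units Scalar (⟨_, h⟩ : denominators)
  have h2 : brace r = (((s ^ r)⁻¹ : Scalarˣ) : Scalar) *
      algebraMap (MvPolynomial (Fin 2) ℤ) Scalar (MvPolynomial.X 1 ^ (2 * r) - 1) := by
    have h3 : algebraMap (MvPolynomial (Fin 2) ℤ) Scalar (MvPolynomial.X 1) = (s : Scalar) := rfl
    have h4 : (((s ^ r)⁻¹ : Scalarˣ) : Scalar) * ((s : Scalar) ^ r) = 1 := by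
      rw [← Units.val_pow_eq_pow_val]; exact Units.inv_mul _
    rw [map_sub, map_pow, map_one, h3, two_mul, pow_add, mul_sub, ← mul_assoc, h4, brace]
    simp
  rw [h2]
  exact (Units.isUnit _).mul h1

/-- `z = s - s⁻¹`, as a unit of `Λ`. -/
def z : Scalarˣ := (isUnit_brace le_rfl : IsUnit (brace 1)).unit

/-- `δ = (v⁻¹ - v) / (s - s⁻¹)`. -/
def δ : Scalar := (((v⁻¹ : Scalarˣ) : Scalar) - (v : Scalar)) * ((z⁻¹ : Scalarˣ) : Scalar)

/-! ### Oriented tangle diagrams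

Diagrams are in general position with respect to the (upward) height in a strip, so that they are
cut by horizontal lines into layers with exactly one crossing, maximum or minimum each. -/

/-- The orientations, read from left to right, of the strands that meet a horizontal line:
`true` is upwards, `false` is downwards. -/
abbrev Obj : Type := List Bool

/-- The elementary pieces: a local minimum, whose left end is oriented by `ε` (and whose right end
is oriented oppositely); a local maximum; a crossing. In `cross true` the strand that
runs from bottom left to top right is the upper one, in `cross false` it is the lower one.
So a crossing of two strands that both run upwards, or both downwards, is positive
for `cross true` and negative for `cross false`. -/
inductive Gen : Type
  | cup (ε : Bool)
  | cap
  | cross (o : Bool)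

/-- `g.Bdry x y`: the piece `g` can have bottom boundary `x` and top boundary `y`. -/
def Gen.Bdry : Gen → Obj → Obj → Prop
  | .cup ε, x, y => x = [] ∧ y = [ε, !ε]
  | .cap, x, y => (∃ ε, x = [ε, !ε]) ∧ y = []
  | .cross _, x, y => ∃ ε η, x = [ε, η] ∧ y = [η, ε]

/-- The number of bottom ends. -/
def Gen.ins : Gen → ℕ
  | .cup _ => 0
  | .cap => 2
  | .cross _ => 2

/-- The number of top ends. -/
def Gen.outs : Gen → ℕ
  | .cup _ => 2
  | .cap => 0
  | .cross _ => 2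

/-- A list of layers from bottom to top; the layer `(k, g)` consists of the piece `g`
with `k` vertical strands on its left (and any number of them on its right). -/
abbrev Word : Type := List (ℕ × Gen)

/-- `Step a (k, g) b`: the layer `(k, g)` leads from the bottom boundary `a` to the top
boundary `b`. -/
def Step (a : Obj) (l : ℕ × Gen) (b : Obj) : Prop :=
  ∃ P Q x y : Obj, P.length = l.1 ∧ l.2.Bdry x y ∧ a = P ++ x ++ Q ∧ b = P ++ y ++ Q

/-- `IsTangle a w b`: the layers `w` fit together to an oriented tangle diagram with
bottom boundary `a` and top boundary `b`. -/
def IsTangle : Obj → Word → Obj → Prop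
  | a, [], b => a = b
  | a, l :: w, b => ∃ c, Step a l c ∧ IsTangle c w b

/-- The layers `w` with `k` more strands on the left. -/
def shift (k : ℕ) (w : Word) : Word := w.map fun l => (k + l.1, l.2)

@[simp] theorem shift_nil (k : ℕ) : shift k [] = [] := rfl

@[simp] theorem shift_cons (k : ℕ) (l : ℕ × Gen) (w : Word) :
    shift k (l :: w) = (k + l.1, l.2) :: shift k w := rfl

@[simp] theorem shift_append (k : ℕ) (w u : Word) : shift k (w ++ u) = shift k w ++ shift k u := by
  simp [shift]

@[simp] theorem shift_shift (k l : ℕ) (w : Word) : shift k (shift l w) = shift (k + l) w := by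
  simp [shift, Function.comp_def, add_assoc]

@[simp] theorem shift_zero (w : Word) : shift 0 w = w := by
  simp [shift]

theorem Step.pad {a b : Obj} {l : ℕ × Gen} (h : Step a l b) (P Q : Obj) :
    Step (P ++ a ++ Q) (P.length + l.1, l.2) (P ++ b ++ Q) := by
  obtain ⟨P', Q', x, y, h1, h2, rfl, rfl⟩ := h
  exact ⟨P ++ P', Q' ++ Q, x, y, by simp [h1], h2, by simp, by simp⟩

theorem IsTangle.append {a b c : Obj} {w u : Word} (h : IsTangle a w b) (h' : IsTangle b u c) :
    IsTangle a (w ++ u) c := by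
  induction w generalizing a with
  | nil => cases h; exact h'
  | cons l w ih =>
    obtain ⟨d, h1, h2⟩ := h
    exact ⟨d, h1, ih h2⟩

theorem IsTangle.pad {a b : Obj} {w : Word} (h : IsTangle a w b) (P Q : Obj) :
    IsTangle (P ++ a ++ Q) (shift P.length w) (P ++ b ++ Q) := by
  induction w generalizing a with
  | nil => cases h; exact rfl
  | cons l w ih =>
    obtain ⟨d, h1, h2⟩ := h
    exact ⟨_, h1.pad P Q, ih h2⟩

/-- Oriented tangle diagrams with bottom boundary `a` and top boundary `b`. -/
@[ext] structure Tangle (a b : Obj) : Type where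
  word : Word
  isTangle : IsTangle a word b

/-- The diagram `f` with the diagram `g` stacked on its top. -/
def Tangle.comp {a b c : Obj} (f : Tangle a b) (g : Tangle b c) : Tangle a c :=
  ⟨f.word ++ g.word, f.isTangle.append g.isTangle⟩

/-- The diagram `f` with vertical strands `P` on its left and `Q` on its right. -/
def Tangle.pad {a b : Obj} (P Q : Obj) (f : Tangle a b) : Tangle (P ++ a ++ Q) (P ++ b ++ Q) :=
  ⟨shift P.length f.word, f.isTangle.pad P Q⟩

/-- Vertical strands only. -/
def Tangle.id (a : Obj) : Tangle a a := ⟨[], rfl⟩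

/-- The elementary moves that generate regular isotopy of diagrams: planar isotopy (first five
constructors) and the Reidemeister moves II and III. Only their leftmost
position is listed here. -/
inductive Move : Word → Word → Prop
  /-- Disjoint pieces change their heights; `d` strands separate them. -/
  | interchange (g h : Gen) (d : ℕ) :
      Move [(0, g), (g.outs + d, h)] [(g.ins + d, h), (0, g)]
  /-- A minimum cancels the maximum next to it. -/
  | zigzag_left (ε : Bool) : Move [(1, .cup ε), (0, .cap)] []
  | zigzag_right (ε : Bool) : Move [(0, .cup ε), (1, .cap)] []
  /-- A crossing slides over a maximum. -/
  | slide_cap (o : Bool) : Move [(0, .cross o), (1, .cap)] [(1, .cross (!o)), (0, .cap)]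
  /-- A crossing slides over a minimum. -/
  | slide_cup (ε o : Bool) :
      Move [(1, .cup ε), (0, .cross o)] [(0, .cup ε), (1, .cross (!o))]
  | reidemeister_two (o : Bool) : Move [(0, .cross o), (0, .cross (!o))] []
  | reidemeister_three (o : Bool) :
      Move [(0, .cross o), (1, .cross o), (0, .cross o)]
        [(1, .cross o), (0, .cross o), (1, .cross o)]

/-! ### Homfly skeins of the rectangle -/

/-- The linear relations of Homfly skein theory, each inside a disc: `LocalRel x y r` says that
the linear combination `r` of diagrams with boundary `x` and `y` is declared to be zero. -/
inductive LocalRel : (x y : Obj) → (Tangle x y →₀ Scalar) → Prop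
  /-- Regular isotopy. -/
  | move {x y : Obj} (f g : Tangle x y) (h : Move f.word g.word) :
      LocalRel x y (Finsupp.single f 1 - Finsupp.single g 1)
  /-- A positive crossing minus a negative crossing is `s - s⁻¹` times the smoothing. -/
  | crossing (ε : Bool) (f g : Tangle [ε, ε] [ε, ε]) (hf : f.word = [(0, .cross true)])
      (hg : g.word = [(0, .cross false)]) :
      LocalRel [ε, ε] [ε, ε] (Finsupp.single f 1 - Finsupp.single g 1
        - Finsupp.single (Tangle.id [ε, ε]) (z : Scalar))
  /-- A positive curl (here on the right of the strand) multiplies by `v⁻¹`. -/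
  | curl_right_pos (ε : Bool) (f : Tangle [ε] [ε])
      (hf : f.word = [(1, .cup ε), (0, .cross true), (1, .cap)]) :
      LocalRel [ε] [ε] (Finsupp.single f 1
        - Finsupp.single (Tangle.id [ε]) ((v⁻¹ : Scalarˣ) : Scalar))
  /-- A negative curl multiplies by `v`. -/
  | curl_right_neg (ε : Bool) (f : Tangle [ε] [ε])
      (hf : f.word = [(1, .cup ε), (0, .cross false), (1, .cap)]) :
      LocalRel [ε] [ε] (Finsupp.single f 1 - Finsupp.single (Tangle.id [ε]) (v : Scalar))
  /-- The same for a curl on the left of the strand. -/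
  | curl_left_pos (ε : Bool) (f : Tangle [ε] [ε])
      (hf : f.word = [(0, .cup (!ε)), (1, .cross true), (0, .cap)]) :
      LocalRel [ε] [ε] (Finsupp.single f 1
        - Finsupp.single (Tangle.id [ε]) ((v⁻¹ : Scalarˣ) : Scalar))
  | curl_left_neg (ε : Bool) (f : Tangle [ε] [ε])
      (hf : f.word = [(0, .cup (!ε)), (1, .cross false), (0, .cap)]) :
      LocalRel [ε] [ε] (Finsupp.single f 1 - Finsupp.single (Tangle.id [ε]) (v : Scalar))
  /-- A trivial circle multiplies by `δ`. -/
  | circle (ε : Bool) (f : Tangle [] []) (hf : f.word = [(0, .cup ε), (0, .cap)]) :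
      LocalRel [] [] (Finsupp.single f 1 - Finsupp.single (Tangle.id []) δ)

/-- The local relations, placed into all diagrams with boundary `a` and `b`. -/
def rectSet (a b : Obj) : Set (Tangle a b →₀ Scalar) :=
  {r' | ∃ (x y P Q : Obj) (f : Tangle a (P ++ x ++ Q)) (g : Tangle (P ++ y ++ Q) b)
    (r : Tangle x y →₀ Scalar), LocalRel x y r ∧
      r' = r.mapDomain fun t => (f.comp (t.pad P Q)).comp g}

def rectRel (a b : Obj) : Submodule Scalar (Tangle a b →₀ Scalar) :=
  Submodule.span Scalar (rectSet a b)

/-! ### The skein of the annulus -/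

/-- Diagrams in the annulus: `base` lists the strands that meet a fixed radius (inner boundary
first), and `word` is the diagram in the rectangle that is left when the annulus is cut open
along this radius. -/
@[ext] structure Diagram : Type where
  base : Obj
  word : Word
  isTangle : IsTangle base word base

/-- The closure of a tangle diagram in the annulus. -/
def Tangle.close {a : Obj} (f : Tangle a a) : Diagram := ⟨a, f.word, f.isTangle⟩

/-- The relations in the skein of the annulus: the local relations, and the independence of the
radius at which the annulus is cut open. -/
def annulusSet : Set (Diagram →₀ Scalar) :=
  {r' | ∃ (a : Obj), ∃ r ∈ rectSet a a, r' = r.mapDomain Tangle.close} ∪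
  {r' | ∃ (a b : Obj) (f : Tangle a b) (g : Tangle b a),
    r' = Finsupp.single (f.comp g).close 1 - Finsupp.single (g.comp f).close 1}

def annulusRel : Submodule Scalar (Diagram →₀ Scalar) := Submodule.span Scalar annulusSet
/-! ### Products -/

section Quotient

theorem quot_induction {D : Type} {N : Submodule Scalar (D →₀ Scalar)} {p : ((D →₀ Scalar) ⧸ N) → Prop} (x : (D →₀ Scalar) ⧸ N)
    (single : ∀ d, p (N.mkQ (Finsupp.single d 1)))
    (zero : p 0) (add : ∀ x y, p x → p y → p (x + y)) (smul : ∀ (c : Scalar) x, p x → p (c • x)) :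
    p x := by
  obtain ⟨x, rfl⟩ := N.mkQ_surjective x
  induction x using Finsupp.induction_linear with
  | zero => simpa using zero
  | add f g hf hg => simpa using add _ _ hf hg
  | single d c =>
    have := smul c _ (single d)
    rwa [← map_smul, Finsupp.smul_single_one] at this

variable {D : Type} [Monoid D]

/-- The bilinear extension of the product of `D`. -/
def freeMul (D : Type) [Monoid D] : (D →₀ Scalar) →ₗ[Scalar] (D →₀ Scalar) →ₗ[Scalar] (D →₀ Scalar) :=
  Finsupp.linearCombination Scalar fun d => Finsupp.lmapDomain Scalar Scalar (d * ·)

theorem freeMul_single_left (d : D) (c : Scalar) (x : D →₀ Scalar) :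
    freeMul D (Finsupp.single d c) x = c • x.mapDomain (d * ·) := by
  simp [freeMul]

theorem freeMul_single_right (d : D) (c : Scalar) (x : D →₀ Scalar) :
    freeMul D x (Finsupp.single d c) = c • x.mapDomain (· * d) := by
  induction x using Finsupp.induction_linear with
  | zero => simp
  | add f g hf hg => simp [hf, hg, Finsupp.mapDomain_add]
  | single e b => simp [freeMul_single_left, mul_comm]

variable (N : Submodule Scalar (D →₀ Scalar))

/-- `N` is a two-sided ideal. -/
structure IsIdeal : Prop where
  left : ∀ (d : D), ∀ x ∈ N, x.mapDomain (d * ·) ∈ N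
  right : ∀ (d : D), ∀ x ∈ N, x.mapDomain (· * d) ∈ N

variable {N}

theorem IsIdeal.mul_left (h : IsIdeal N) (y : D →₀ Scalar) {x : D →₀ Scalar} (hx : x ∈ N) :
    freeMul D y x ∈ N := by
  induction y using Finsupp.induction_linear with
  | zero => simp
  | add f g hf hg => simpa using N.add_mem hf hg
  | single e b => rw [freeMul_single_left]; exact N.smul_mem _ (h.left _ _ hx)

theorem IsIdeal.mul_right (h : IsIdeal N) (y : D →₀ Scalar) {x : D →₀ Scalar} (hx : x ∈ N) :
    freeMul D x y ∈ N := by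
  induction y using Finsupp.induction_linear with
  | zero => simp
  | add f g hf hg => simpa using N.add_mem hf hg
  | single e b => rw [freeMul_single_right]; exact N.smul_mem _ (h.right _ _ hx)

/-- The product of `D` extended bilinearly to the quotient by `N`. -/
def quotMul (h : IsIdeal N) :
    ((D →₀ Scalar) ⧸ N) →ₗ[Scalar] ((D →₀ Scalar) ⧸ N) →ₗ[Scalar] ((D →₀ Scalar) ⧸ N) :=
  N.liftQ
    { toFun := fun x => N.liftQ (N.mkQ ∘ₗ freeMul D x) fun y hy => by
        simpa using h.mul_left x hy
      map_add' := fun x y => by ext; simp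
      map_smul' := fun c x => by ext; simp }
    fun x hx => by
      rw [LinearMap.mem_ker]
      ext y
      simpa using h.mul_right _ hx

@[simp] theorem quotMul_mk (h : IsIdeal N) (x y : D →₀ Scalar) :
    quotMul h (N.mkQ x) (N.mkQ y) = N.mkQ (freeMul D x y) := rfl

/-- The quotient of the linear span of `D` by a two-sided ideal is a ring. -/
abbrev quotRing (h : IsIdeal N) : Ring ((D →₀ Scalar) ⧸ N) where
  __ := (inferInstance : AddCommGroup ((D →₀ Scalar) ⧸ N))
  mul x y := quotMul h x y
  one := N.mkQ (Finsupp.single 1 1)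
  mul_assoc x y w := by
    change quotMul h (quotMul h x y) w = quotMul h x (quotMul h y w)
    induction x using quot_induction with
    | zero => simp
    | add x x' hx hx' => simp [hx, hx']
    | smul c x hx => simp [hx]
    | single d =>
    induction y using quot_induction with
    | zero => simp
    | add x x' hx hx' => simp only [map_add, LinearMap.add_apply, hx, hx']
    | smul c x hx => simp only [map_smul, LinearMap.smul_apply, hx]
    | single e =>
    induction w using quot_induction with
    | zero => simp
    | add x x' hx hx' => simp only [map_add, hx, hx']
    | smul c x hx => simp only [map_smul, hx]
    | single f => simp only [quotMul_mk, freeMul_single_left, one_smul, Finsupp.mapDomain_single, mul_assoc]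
  zero_mul x := by change quotMul h 0 x = 0; simp
  mul_zero x := by change quotMul h x 0 = 0; simp
  left_distrib x y w := by change quotMul h x (y + w) = quotMul h x y + quotMul h x w; simp
  right_distrib x y w := by change quotMul h (x + y) w = quotMul h x w + quotMul h y w; simp
  one_mul x := by
    change quotMul h (N.mkQ (Finsupp.single 1 1)) x = x
    induction x using quot_induction with
    | zero => simp
    | add x x' hx hx' => simp only [map_add, hx, hx']
    | smul c x hx => simp only [map_smul, hx]
    | single f => simp only [quotMul_mk, freeMul_single_left, one_smul, Finsupp.mapDomain_single, one_mul]
  mul_one x := by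
    change quotMul h x (N.mkQ (Finsupp.single 1 1)) = x
    induction x using quot_induction with
    | zero => simp
    | add x x' hx hx' => simp only [map_add, LinearMap.add_apply, hx, hx']
    | smul c x hx => simp only [map_smul, LinearMap.smul_apply, hx]
    | single f => simp only [quotMul_mk, freeMul_single_left, one_smul, Finsupp.mapDomain_single, mul_one]

end Quotient

/-- Diagrams in the rectangle are multiplied by stacking. -/
instance (a : Obj) : Monoid (Tangle a a) where
  mul f g := f.comp g
  one := Tangle.id a
  mul_assoc f g h := Tangle.ext (List.append_assoc _ _ _)
  one_mul f := Tangle.ext (List.nil_append _)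
  mul_one f := Tangle.ext (List.append_nil _)

/-- Diagrams in the annulus are multiplied by placing one annulus outside the other. -/
instance : Monoid Diagram where
  mul d e := ⟨d.base ++ e.base, d.word ++ shift d.base.length e.word,
    IsTangle.append (by simpa using d.isTangle.pad [] e.base)
      (by simpa using e.isTangle.pad d.base [])⟩
  one := ⟨[], [], rfl⟩
  mul_assoc d e f := Diagram.ext (List.append_assoc _ _ _) (by
    change (d.word ++ shift _ e.word) ++ shift (d.base ++ e.base).length f.word =
      d.word ++ shift _ (e.word ++ shift _ f.word)
    simp)
  one_mul d := Diagram.ext (List.nil_append _) (by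
    change [] ++ shift 0 d.word = d.word
    simp)
  mul_one d := Diagram.ext (List.append_nil _) (by
    change d.word ++ shift _ [] = d.word
    simp)

theorem Diagram.mul_base (d e : Diagram) : (d * e).base = d.base ++ e.base := rfl

theorem Diagram.mul_word (d e : Diagram) :
    (d * e).word = d.word ++ shift d.base.length e.word := rfl

theorem mapDomain_single_sub {α β : Type} (f : α → β) (a b : α) :
    Finsupp.mapDomain f (Finsupp.single a (1 : Scalar) - Finsupp.single b 1) =
      Finsupp.single (f a) 1 - Finsupp.single (f b) 1 := by
  rw [← Finsupp.lmapDomain_apply Scalar Scalar, map_sub]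
  simp

theorem mapDomain_mem_of_span {α β : Type} {S : Set (α →₀ Scalar)}
    {N : Submodule Scalar (β →₀ Scalar)} (f : α → β) (h : ∀ r ∈ S, r.mapDomain f ∈ N)
    {x : α →₀ Scalar} (hx : x ∈ Submodule.span Scalar S) : x.mapDomain f ∈ N := by
  have : Submodule.span Scalar S ≤ N.comap (Finsupp.lmapDomain Scalar Scalar f) :=
    Submodule.span_le.2 fun r hr => h r hr
  exact this hx

theorem rectSet_context {a b c d : Obj} (F : Tangle a b → Tangle c d)
    (P Q : Obj) (w u : Word) (hw : IsTangle c w (P ++ a ++ Q)) (hu : IsTangle (P ++ b ++ Q) u d)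
    (hF : ∀ t, (F t).word = w ++ shift P.length t.word ++ u)
    {r : Tangle a b →₀ Scalar} (hr : r ∈ rectSet a b) : r.mapDomain F ∈ rectSet c d := by
  obtain ⟨x, y, P', Q', f, g, r, hr, rfl⟩ := hr
  refine ⟨x, y, P ++ P', Q' ++ Q,
    ⟨w ++ shift P.length f.word, hw.append (by simpa using f.isTangle.pad P Q)⟩,
    ⟨shift P.length g.word ++ u, IsTangle.append (by simpa using g.isTangle.pad P Q) hu⟩,
    r, hr, ?_⟩
  rw [← Finsupp.mapDomain_comp]
  congr 1
  funext t
  apply Tangle.ext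
  simp [hF, Tangle.comp, Tangle.pad]

theorem rectRel_isIdeal (a : Obj) : IsIdeal (rectRel a a) where
  left d _ hx := mapDomain_mem_of_span (S := rectSet a a) _ (fun _ hr => Submodule.subset_span
    (rectSet_context _ [] [] d.word [] (by simpa using d.isTangle) (by simp [IsTangle])
      (fun t => by simp [HMul.hMul, Mul.mul, Tangle.comp]) hr)) hx
  right d _ hx := mapDomain_mem_of_span (S := rectSet a a) _ (fun _ hr => Submodule.subset_span
    (rectSet_context _ [] [] [] d.word (by simp [IsTangle]) (by simpa using d.isTangle)
      (fun t => by simp [HMul.hMul, Mul.mul, Tangle.comp]) hr)) hx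

/-! ### Isotopy of words -/

/-- `w` and `u` are diagrams with boundary `a` and `b` that agree in the skein. -/
def Iso (a b : Obj) (w u : Word) : Prop :=
  ∃ (hw : IsTangle a w b) (hu : IsTangle a u b),
    Finsupp.single (⟨w, hw⟩ : Tangle a b) (1 : Scalar) - Finsupp.single ⟨u, hu⟩ 1 ∈ rectRel a b

theorem Iso.refl {a b : Obj} {w : Word} (hw : IsTangle a w b) : Iso a b w w :=
  ⟨hw, hw, by simp⟩

theorem Iso.symm {a b : Obj} {w u : Word} (h : Iso a b w u) : Iso a b u w := by
  obtain ⟨hw, hu, h⟩ := h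
  exact ⟨hu, hw, by simpa using neg_mem h⟩

theorem Iso.trans {a b : Obj} {w u t : Word} (h : Iso a b w u) (h' : Iso a b u t) :
    Iso a b w t := by
  obtain ⟨hw, hu, h⟩ := h
  obtain ⟨hu', ht, h'⟩ := h'
  exact ⟨hw, ht, by simpa using add_mem h h'⟩

theorem Iso.context {a b c d : Obj} {w u : Word} (h : Iso a b w u) (P Q : Obj) {w₁ w₂ : Word}
    (h₁ : IsTangle c w₁ (P ++ a ++ Q)) (h₂ : IsTangle (P ++ b ++ Q) w₂ d) :
    Iso c d (w₁ ++ shift P.length w ++ w₂) (w₁ ++ shift P.length u ++ w₂) := by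
  obtain ⟨hw, hu, h⟩ := h
  refine ⟨(h₁.append (hw.pad P Q)).append h₂, (h₁.append (hu.pad P Q)).append h₂, ?_⟩
  have := mapDomain_mem_of_span (N := rectRel c d)
    (fun t : Tangle a b => (⟨w₁ ++ shift P.length t.word ++ w₂,
      (h₁.append (t.isTangle.pad P Q)).append h₂⟩ : Tangle c d))
    (fun _ hr => Submodule.subset_span
      (rectSet_context _ P Q w₁ w₂ h₁ h₂ (fun t => rfl) hr)) h
  rwa [mapDomain_single_sub] at this

theorem Iso.append_left {a b c : Obj} {w u t : Word} (ht : IsTangle a t b) (h : Iso b c w u) :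
    Iso a c (t ++ w) (t ++ u) := by
  simpa using h.context (w₁ := t) (w₂ := []) [] [] (by simpa using ht) (by simp [IsTangle])

theorem Iso.append_right {a b c : Obj} {w u t : Word} (h : Iso a b w u) (ht : IsTangle b t c) :
    Iso a c (w ++ t) (u ++ t) := by
  simpa using h.context (w₁ := []) (w₂ := t) [] [] (by simp [IsTangle]) (by simpa using ht)

theorem Iso.pad {a b : Obj} {w u : Word} (h : Iso a b w u) (P Q : Obj) :
    Iso (P ++ a ++ Q) (P ++ b ++ Q) (shift P.length w) (shift P.length u) := by
  simpa using h.context (w₁ := []) (w₂ := []) P Q (by simp [IsTangle]) (by simp [IsTangle])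

theorem Iso.of_move {a b : Obj} {w u : Word} (h : Move w u) (hw : IsTangle a w b)
    (hu : IsTangle a u b) : Iso a b w u :=
  ⟨hw, hu, Submodule.subset_span ⟨a, b, [], [], ⟨[], by simp [IsTangle]⟩, ⟨[], by simp [IsTangle]⟩,
    _, .move ⟨w, hw⟩ ⟨u, hu⟩ h, by
      rw [mapDomain_single_sub]
      simp [Tangle.comp, Tangle.pad]⟩⟩

theorem Iso.left {a b : Obj} {w u : Word} (h : Iso a b w u) : IsTangle a w b := h.1

theorem Iso.right {a b : Obj} {w u : Word} (h : Iso a b w u) : IsTangle a u b := h.2.1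

theorem IsTangle.padLeft {a b : Obj} {w : Word} (h : IsTangle a w b) (P : Obj) :
    IsTangle (P ++ a) (shift P.length w) (P ++ b) := by simpa using h.pad P []

theorem IsTangle.padRight {a b : Obj} {w : Word} (h : IsTangle a w b) (Q : Obj) :
    IsTangle (a ++ Q) w (b ++ Q) := by simpa using h.pad [] Q

theorem Iso.padLeft {a b : Obj} {w u : Word} (h : Iso a b w u) (P : Obj) :
    Iso (P ++ a) (P ++ b) (shift P.length w) (shift P.length u) := by simpa using h.pad P []

theorem Iso.padRight {a b : Obj} {w u : Word} (h : Iso a b w u) (Q : Obj) :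
    Iso (a ++ Q) (b ++ Q) w u := by simpa using h.pad [] Q

theorem isTangle_singleton {a b : Obj} {l : ℕ × Gen} : IsTangle a [l] b ↔ Step a l b := by
  simp [IsTangle]

theorem Gen.Bdry.length {g : Gen} {x y : Obj} (h : g.Bdry x y) :
    x.length = g.ins ∧ y.length = g.outs := by
  cases g <;> simp only [Gen.Bdry] at h
  · obtain ⟨rfl, rfl⟩ := h; simp [Gen.ins, Gen.outs]
  · obtain ⟨⟨ε, rfl⟩, rfl⟩ := h; simp [Gen.ins, Gen.outs]
  · obtain ⟨ε, η, rfl, rfl⟩ := h; simp [Gen.ins, Gen.outs]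

theorem iso_interchange_layer {a b c d : Obj} {l m : ℕ × Gen} (h : Step a l b) (h' : Step c m d) :
    Iso (a ++ c) (b ++ d) ([l] ++ shift b.length [m]) (shift a.length [m] ++ [l]) := by
  have t1 : IsTangle (a ++ c) ([l] ++ shift b.length [m]) (b ++ d) :=
    ((isTangle_singleton.2 h).padRight c).append ((isTangle_singleton.2 h').padLeft b)
  have t2 : IsTangle (a ++ c) (shift a.length [m] ++ [l]) (b ++ d) :=
    ((isTangle_singleton.2 h').padLeft a).append ((isTangle_singleton.2 h).padRight d)
  obtain ⟨P, Q, x, y, hP, hxy, rfl, rfl⟩ := h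
  obtain ⟨P', Q', x', y', hP', hxy', rfl, rfl⟩ := h'
  obtain ⟨k, g⟩ := l
  obtain ⟨k', g'⟩ := m
  dsimp only at hP hP' hxy hxy'
  subst hP hP'
  have s1 : Step x (0, g) y := ⟨[], [], x, y, rfl, hxy, by simp, by simp⟩
  have s2 : Step (Q ++ P' ++ x') (Q.length + P'.length, g') (Q ++ P' ++ y') :=
    ⟨Q ++ P', [], x', y', by simp, hxy', by simp, by simp⟩
  have key : Iso (x ++ (Q ++ P' ++ x')) (y ++ (Q ++ P' ++ y'))
      ([(0, g)] ++ shift y.length [(Q.length + P'.length, g')])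
      (shift x.length [(Q.length + P'.length, g')] ++ [(0, g)]) := by
    refine Iso.of_move ?_
      (((isTangle_singleton.2 s1).padRight _).append ((isTangle_singleton.2 s2).padLeft y))
      (((isTangle_singleton.2 s2).padLeft x).append ((isTangle_singleton.2 s1).padRight _))
    have := Move.interchange g g' (Q.length + P'.length)
    simpa [hxy.length.1, hxy.length.2] using this
  have := key.pad P Q'
  simpa [add_assoc, add_comm, add_left_comm] using this

theorem iso_interchange_one {a b c d : Obj} {l : ℕ × Gen} {u : Word} (h : Step a l b)
    (h' : IsTangle c u d) :
    Iso (a ++ c) (b ++ d) ([l] ++ shift b.length u) (shift a.length u ++ [l]) := by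
  induction u generalizing c with
  | nil =>
    cases h'
    exact Iso.refl ((isTangle_singleton.2 h).padRight _)
  | cons m u ih =>
    obtain ⟨e, h1, h2⟩ := h'
    have e1 := (iso_interchange_layer h h1).append_right (h2.padLeft b)
    have e2 := (ih h2).append_left ((isTangle_singleton.2 h1).padLeft a)
    refine Iso.trans (by simpa using e1) (by simpa using e2)

theorem iso_interchange {a b c d : Obj} {w u : Word} (h : IsTangle a w b) (h' : IsTangle c u d) :
    Iso (a ++ c) (b ++ d) (w ++ shift b.length u) (shift a.length u ++ w) := by
  induction w generalizing a with
  | nil =>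
    cases h
    simpa using Iso.refl (h'.padLeft _)
  | cons l w ih =>
    obtain ⟨e, h1, h2⟩ := h
    have e1 := (ih h2).append_left ((isTangle_singleton.2 h1).padRight c)
    have e2 := (iso_interchange_one h1 h').append_right (h2.padRight d)
    refine Iso.trans (by simpa using e1) (by simpa using e2)

/-- The two diagrams in the annulus agree in the skein. -/
def ClosedIso (d e : Diagram) : Prop :=
  Finsupp.single d (1 : Scalar) - Finsupp.single e 1 ∈ annulusRel

theorem ClosedIso.trans {d e f : Diagram} (h : ClosedIso d e) (h' : ClosedIso e f) :
    ClosedIso d f := by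
  have := add_mem h h'
  rwa [sub_add_sub_cancel] at this

theorem ClosedIso.symm {d e : Diagram} (h : ClosedIso d e) : ClosedIso e d := by
  have := neg_mem h
  rwa [neg_sub] at this

theorem Iso.close {a : Obj} {w u : Word} (h : Iso a a w u) :
    ClosedIso ⟨a, w, h.left⟩ ⟨a, u, h.right⟩ := by
  obtain ⟨hw, hu, h⟩ := h
  have := mapDomain_mem_of_span (N := annulusRel) Tangle.close
    (fun r hr => Submodule.subset_span (Or.inl ⟨a, r, hr, rfl⟩)) h
  rwa [mapDomain_single_sub] at this

theorem closedIso_rotate {a b : Obj} {w u : Word} (hw : IsTangle a w b) (hu : IsTangle b u a) :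
    ClosedIso ⟨a, w ++ u, hw.append hu⟩ ⟨b, u ++ w, hu.append hw⟩ :=
  Submodule.subset_span (Or.inr ⟨a, b, ⟨w, hw⟩, ⟨u, hu⟩, rfl⟩)

theorem annulusRel_isIdeal : IsIdeal annulusRel where
  left d _ hx := by
    refine mapDomain_mem_of_span (S := annulusSet) _ ?_ hx
    rintro _ (⟨a, r, hr, rfl⟩ | ⟨a, b, f, g, rfl⟩)
    · refine Submodule.subset_span (Or.inl ⟨d.base ++ a, _,
        rectSet_context (fun t : Tangle a a => (⟨d.word ++ shift d.base.length t.word, (d.isTangle.padRight a).append (t.isTangle.padLeft d.base)⟩ :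
          Tangle (d.base ++ a) (d.base ++ a))) d.base [] d.word []
          (by simpa using d.isTangle.padRight a) (by simp [IsTangle]) (fun t => by simp) hr, ?_⟩)
      rw [← Finsupp.mapDomain_comp, ← Finsupp.mapDomain_comp]
      rfl
    · rw [mapDomain_single_sub]
      have e1 := ((iso_interchange d.isTangle f.isTangle).append_right
        (g.isTangle.padLeft d.base)).close
      have e2 := closedIso_rotate (f.isTangle.padLeft d.base)
        ((d.isTangle.padRight b).append (g.isTangle.padLeft d.base))
      have := e1.trans (by simpa using e2)
      simpa [ClosedIso, HMul.hMul, Mul.mul, Tangle.comp, Tangle.close] using this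
  right d _ hx := by
    refine mapDomain_mem_of_span (S := annulusSet) _ ?_ hx
    rintro _ (⟨a, r, hr, rfl⟩ | ⟨a, b, f, g, rfl⟩)
    · refine Submodule.subset_span (Or.inl ⟨a ++ d.base, _,
        rectSet_context (fun t : Tangle a a => (⟨t.word ++ shift a.length d.word, (t.isTangle.padRight d.base).append (d.isTangle.padLeft a)⟩ :
          Tangle (a ++ d.base) (a ++ d.base))) [] d.base [] (shift a.length d.word)
          (by simp [IsTangle]) (by simpa using d.isTangle.padLeft a) (fun t => by simp) hr, ?_⟩)
      rw [← Finsupp.mapDomain_comp, ← Finsupp.mapDomain_comp]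
      rfl
    · rw [mapDomain_single_sub]
      have e1 := ((iso_interchange g.isTangle d.isTangle).append_left
        (f.isTangle.padRight d.base)).close
      have e2 := closedIso_rotate ((f.isTangle.padRight d.base).append (d.isTangle.padLeft b))
        (g.isTangle.padRight d.base)
      have := e1.trans (by simpa using e2)
      simpa [ClosedIso, HMul.hMul, Mul.mul, Tangle.comp, Tangle.close] using this

/-! ### The meridian -/

/-- The strand at position `k` passes to the right across `n` strands: above them if `o` is
`true`, below them if `o` is `false`. -/
def pass (o : Bool) (k n : ℕ) : Word := (List.range n).map fun i => (k + i, Gen.cross o)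

/-- A circle around `n` strands, which runs above the strands and back below them. Its left end
is oriented by `ε`, so its upper part is directed from left to right for `ε = false`. -/
def meridianWord (ε : Bool) (n : ℕ) : Word :=
  [(0, Gen.cup ε)] ++ pass true 1 n ++ pass false 0 n ++ [(n, Gen.cap)]

theorem shift_pass (o : Bool) (j k n : ℕ) : shift j (pass o k n) = pass o (j + k) n := by
  simp [pass, shift, Function.comp_def, add_assoc]

theorem pass_add (o : Bool) (k m n : ℕ) : pass o k (m + n) = pass o k m ++ pass o (k + m) n := by
  simp [pass, List.range_add, Function.comp_def, add_assoc]

theorem isTangle_pass (o η : Bool) (a : Obj) : IsTangle (η :: a) (pass o 0 a.length) (a ++ [η]) := by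
  induction a with
  | nil => rfl
  | cons ε a ih =>
    rw [List.length_cons, add_comm, pass_add]
    refine IsTangle.append (b := ε :: η :: a) ?_ ?_
    · exact isTangle_singleton.2 ⟨[], a, [η, ε], [ε, η], rfl, ⟨_, _, rfl, rfl⟩, rfl, rfl⟩
    · simpa [shift_pass] using ih.padLeft [ε]

theorem isTangle_gen {g : Gen} {x y : Obj} (h : g.Bdry x y) : IsTangle x [(0, g)] y :=
  isTangle_singleton.2 ⟨[], [], x, y, rfl, h, by simp, by simp⟩

theorem isTangle_cross (o ε η : Bool) : IsTangle [ε, η] [(0, .cross o)] [η, ε] :=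
  isTangle_gen ⟨ε, η, rfl, rfl⟩

theorem iso_two (o ε η : Bool) : Iso [ε, η] [ε, η] [(0, .cross o), (0, .cross (!o))] [] :=
  Iso.of_move (.reidemeister_two o)
    ((isTangle_cross o ε η).append (isTangle_cross (!o) η ε)) rfl

/-- A strand can pass over, or under, a single piece. -/
theorem iso_pass_core (o η : Bool) {g : Gen} {x y : Obj} (h : g.Bdry x y) :
    Iso (η :: x) (y ++ [η]) (pass o 0 x.length ++ [(0, g)]) ((1, g) :: pass o 0 y.length) := by
  have t1 : IsTangle (η :: x) (pass o 0 x.length ++ [(0, g)]) (y ++ [η]) :=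
    (isTangle_pass o η x).append ((isTangle_gen h).padRight [η])
  have t2 : IsTangle (η :: x) ([(1, g)] ++ pass o 0 y.length) (y ++ [η]) :=
    ((isTangle_gen h).padLeft [η]).append (isTangle_pass o η y)
  cases g with
  | cup ε =>
    obtain ⟨rfl, rfl⟩ := h
    have c1 : IsTangle [η] [(0, .cup ε)] ([ε, !ε] ++ [η]) :=
      (isTangle_gen (g := .cup ε) ⟨rfl, rfl⟩).padRight [η]
    have c2 : IsTangle [η] [(1, .cup ε)] ([η] ++ [ε, !ε]) :=
      (isTangle_gen (g := .cup ε) ⟨rfl, rfl⟩).padLeft [η]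
    have e1 : Iso [η] [ε, η, !ε] [(1, .cup ε), (0, .cross o)] [(0, .cup ε), (1, .cross (!o))] :=
      Iso.of_move (.slide_cup ε o) (c2.append ((isTangle_cross o η ε).padRight [!ε]))
        (c1.append ((isTangle_cross (!o) (!ε) η).padLeft [ε]))
    have e2 := e1.append_right ((isTangle_cross o η (!ε)).padLeft [ε])
    have e3 := ((iso_two (!o) (!ε) η).padLeft [ε]).append_left c1
    refine (Iso.trans (u := [(0, .cup ε), (1, .cross (!o)), (1, .cross o)]) ?_ ?_).symm
    · simpa [pass, List.range_succ] using e2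
    · simpa [pass] using e3
  | cap =>
    obtain ⟨⟨ε, rfl⟩, rfl⟩ := h
    have c1 : IsTangle ([ε, !ε] ++ [η]) [(0, .cap)] [η] :=
      (isTangle_gen (g := .cap) ⟨⟨ε, rfl⟩, rfl⟩).padRight [η]
    have c2 : IsTangle ([η] ++ [ε, !ε]) [(1, .cap)] [η] :=
      (isTangle_gen (g := .cap) ⟨⟨ε, rfl⟩, rfl⟩).padLeft [η]
    have e1 : Iso [ε, η, !ε] [η] [(0, .cross (!o)), (1, .cap)] [(1, .cross (!(!o))), (0, .cap)] :=
      Iso.of_move (.slide_cap (!o)) (((isTangle_cross (!o) ε η).padRight [!ε]).append c2)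
        (((isTangle_cross (!(!o)) η (!ε)).padLeft [ε]).append c1)
    have e2 := e1.append_left ((isTangle_cross o η ε).padRight [!ε])
    have e3 := ((iso_two o η ε).padRight [!ε]).append_right c2
    refine Iso.trans (u := [(0, .cross o), (0, .cross (!o)), (1, .cap)]) ?_ ?_
    · simpa [pass, List.range_succ] using e2.symm
    · simpa [pass] using e3
  | cross p =>
    obtain ⟨ε, θ, rfl, rfl⟩ := h
    have r3 : ∀ α β γ : Bool, Iso [α, β, γ] [γ, β, α]
        [(0, .cross o), (1, .cross o), (0, .cross o)]
        [(1, .cross o), (0, .cross o), (1, .cross o)] := fun α β γ =>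
      Iso.of_move (.reidemeister_three o)
        (((isTangle_cross o α β).padRight [γ]).append
          (((isTangle_cross o α γ).padLeft [β]).append ((isTangle_cross o β γ).padRight [α])))
        (((isTangle_cross o β γ).padLeft [α]).append
          (((isTangle_cross o α γ).padRight [β]).append ((isTangle_cross o α β).padLeft [γ])))
    rcases Bool.eq_or_eq_not p o with rfl | rfl
    · simpa [pass, List.range_succ] using r3 η ε θ
    · have e1 := ((r3 η θ ε).append_right ((isTangle_cross (!o) ε θ).padRight [η])).append_left
        ((isTangle_cross (!o) ε θ).padLeft [η])
      have e2 := ((iso_two o θ ε).padRight [η]).append_left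
        ((((isTangle_cross (!o) ε θ).padLeft [η]).append
          ((isTangle_cross o η θ).padRight [ε])).append ((isTangle_cross o η ε).padLeft [θ]))
      have e3 := ((iso_two (!o) ε θ).padLeft [η]).append_right
        ((((isTangle_cross o η ε).padRight [θ]).append ((isTangle_cross o η θ).padLeft [ε])).append
          ((isTangle_cross (!o) ε θ).padRight [η]))
      have e1' : Iso [η, ε, θ] [θ, ε, η]
          [(1, .cross (!o)), (0, .cross o), (1, .cross o), (0, .cross o), (0, .cross (!o))]
          [(1, .cross (!o)), (1, .cross o), (0, .cross o), (1, .cross o), (0, .cross (!o))] := by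
        simpa using e1
      have e2' : Iso [η, ε, θ] [θ, ε, η]
          [(1, .cross (!o)), (0, .cross o), (1, .cross o), (0, .cross o), (0, .cross (!o))]
          [(1, .cross (!o)), (0, .cross o), (1, .cross o)] := by
        simpa using e2
      have e3' : Iso [η, ε, θ] [θ, ε, η]
          [(1, .cross (!o)), (1, .cross o), (0, .cross o), (1, .cross o), (0, .cross (!o))]
          [(0, .cross o), (1, .cross o), (0, .cross (!o))] := by
        simpa using e3
      simpa [pass, List.range_succ] using e3'.symm.trans (e1'.symm.trans e2')

theorem iso_pass (o η : Bool) {a b : Obj} {l : ℕ × Gen} (h : Step a l b) :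
    Iso (η :: a) (b ++ [η]) (pass o 0 a.length ++ [l]) ((1 + l.1, l.2) :: pass o 0 b.length) := by
  obtain ⟨P, Q, x, y, hP, hxy, rfl, rfl⟩ := h
  obtain ⟨k, g⟩ := l
  dsimp only at hP hxy
  subst hP
  have t1 : IsTangle (η :: (P ++ x ++ Q)) (pass o 0 P.length) (P ++ η :: (x ++ Q)) := by
    simpa using (isTangle_pass o η P).padRight (x ++ Q)
  have t2 : IsTangle (P ++ η :: (x ++ Q)) (pass o P.length x.length) (P ++ (x ++ η :: Q)) := by
    simpa [shift_pass] using ((isTangle_pass o η x).padRight Q).padLeft P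
  have e1 := ((iso_interchange (isTangle_gen hxy)
    (isTangle_pass o η Q)).padLeft P).symm.append_left (t1.append t2)
  have e2 := ((iso_pass_core o η hxy).pad P Q).context [] []
    (w₁ := pass o 0 P.length) (w₂ := shift (P.length + y.length) (pass o 0 Q.length))
    (by simpa using (isTangle_pass o η P).padRight (x ++ Q))
    (by simpa using (isTangle_pass o η Q).padLeft (P ++ y))
  have t3 : IsTangle (P ++ [η] ++ y ++ Q) (shift P.length (pass o 0 y.length))
      (P ++ (y ++ [η]) ++ Q) := by
    simpa using ((isTangle_pass o η y).padLeft P).padRight Q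
  have t4 : IsTangle (P ++ (y ++ [η]) ++ Q) (shift (P ++ y).length (pass o 0 Q.length))
      (P ++ y ++ (Q ++ [η])) := by
    simpa using (isTangle_pass o η Q).padLeft (P ++ y)
  have e3 := ((iso_interchange (isTangle_pass o η P) (isTangle_gen hxy)).padRight Q).append_right
    (t3.append t4)
  have f1 : Iso (η :: (P ++ x ++ Q)) (P ++ y ++ Q ++ [η])
      (pass o 0 P.length ++ pass o P.length x.length ++ pass o (P.length + x.length) Q.length ++
        [(P.length, g)])
      (pass o 0 P.length ++ pass o P.length x.length ++ [(P.length, g)] ++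
        pass o (P.length + y.length) Q.length) := by
    simpa [shift_pass] using e1
  have f2 : Iso (η :: (P ++ x ++ Q)) (P ++ y ++ Q ++ [η])
      (pass o 0 P.length ++ pass o P.length x.length ++ [(P.length, g)] ++
        pass o (P.length + y.length) Q.length)
      (pass o 0 P.length ++ [(P.length + 1, g)] ++ pass o P.length y.length ++
        pass o (P.length + y.length) Q.length) := by
    simpa [shift_pass] using e2
  have f3 : Iso (η :: (P ++ x ++ Q)) (P ++ y ++ Q ++ [η])
      (pass o 0 P.length ++ [(P.length + 1, g)] ++ pass o P.length y.length ++
        pass o (P.length + y.length) Q.length)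
      ([(P.length + 1, g)] ++ pass o 0 P.length ++ pass o P.length y.length ++
        pass o (P.length + y.length) Q.length) := by
    simpa [shift_pass] using e3
  have := f1.trans (f2.trans f3)
  rw [add_comm P.length 1] at this
  simpa [pass_add, ← add_assoc] using this

theorem isTangle_meridianWord (ε : Bool) (a : Obj) :
    IsTangle a (meridianWord ε a.length) a := by
  have h1 := (isTangle_gen (g := .cup ε) ⟨rfl, rfl⟩).padRight a
  have h2 := (isTangle_pass true (!ε) a).padLeft [ε]
  have h3 := (isTangle_pass false ε a).padRight [!ε]
  have h4 := (isTangle_gen (g := .cap) ⟨⟨ε, rfl⟩, rfl⟩).padLeft a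
  have := ((h1.append h2).append (by simpa using h3)).append (by simpa using h4)
  simpa [meridianWord, shift_pass] using this

theorem iso_meridian_layer (ε : Bool) {a b : Obj} {l : ℕ × Gen} (h : Step a l b) :
    Iso a b (meridianWord ε a.length ++ [l]) (l :: meridianWord ε b.length) := by
  have hl := isTangle_singleton.2 h
  have cup : IsTangle [] [(0, .cup ε)] [ε, !ε] := isTangle_gen (g := .cup ε) ⟨rfl, rfl⟩
  have cap : IsTangle [ε, !ε] [(0, .cap)] [] := isTangle_gen (g := .cap) ⟨⟨ε, rfl⟩, rfl⟩
  have ha1 := cup.padRight a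
  have ha2 := (isTangle_pass true (!ε) a).padLeft [ε]
  have ha3 := (isTangle_pass false ε a).padRight [!ε]
  have hb2 := (isTangle_pass true (!ε) b).padLeft [ε]
  have hb3 := (isTangle_pass false ε b).padRight [!ε]
  have hb4 := cap.padLeft b
  have e1 := (iso_interchange hl cap).symm.append_left
    ((ha1.append ha2).append (by simpa using ha3))
  have e2 := (((iso_pass false ε h).padRight [!ε]).append_left
    (by simpa using ha1.append ha2)).append_right (by simpa using hb4)
  have e3 := (((iso_pass true (!ε) h).padLeft [ε]).append_left
    (by simpa using ha1)).append_right (by simpa using hb3.append (by simpa using hb4))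
  have e4 := (iso_interchange cup hl).append_right
    (by simpa using hb2.append (by simpa using hb3.append (by simpa using hb4)))
  have f1 : Iso a b
      ([(0, .cup ε)] ++ pass true 1 a.length ++ pass false 0 a.length ++ [(a.length, .cap)] ++ [l])
      ([(0, .cup ε)] ++ pass true 1 a.length ++ pass false 0 a.length ++ [l] ++
        [(b.length, .cap)]) := by
    simpa [shift_pass] using e1
  have f2 : Iso a b
      ([(0, .cup ε)] ++ pass true 1 a.length ++ pass false 0 a.length ++ [l] ++
        [(b.length, .cap)])
      ([(0, .cup ε)] ++ pass true 1 a.length ++ [(1 + l.1, l.2)] ++ pass false 0 b.length ++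
        [(b.length, .cap)]) := by
    simpa [shift_pass] using e2
  have f3 : Iso a b
      ([(0, .cup ε)] ++ pass true 1 a.length ++ [(1 + l.1, l.2)] ++ pass false 0 b.length ++
        [(b.length, .cap)])
      ([(0, .cup ε)] ++ [(2 + l.1, l.2)] ++ pass true 1 b.length ++ pass false 0 b.length ++
        [(b.length, .cap)]) := by
    have : 1 + (1 + l.1) = 2 + l.1 := by omega
    simpa [shift_pass, this] using e3
  have f4 : Iso a b
      ([(0, .cup ε)] ++ [(2 + l.1, l.2)] ++ pass true 1 b.length ++ pass false 0 b.length ++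
        [(b.length, .cap)])
      ([l] ++ [(0, .cup ε)] ++ pass true 1 b.length ++ pass false 0 b.length ++
        [(b.length, .cap)]) := by
    simpa [shift_pass] using e4
  have := f1.trans (f2.trans (f3.trans f4))
  simpa [meridianWord] using this

theorem iso_meridian (ε : Bool) {a b : Obj} {w : Word} (h : IsTangle a w b) :
    Iso a b (meridianWord ε a.length ++ w) (w ++ meridianWord ε b.length) := by
  induction w generalizing a with
  | nil =>
    cases h
    simpa using Iso.refl (isTangle_meridianWord ε _)
  | cons l w ih =>
    obtain ⟨c, h1, h2⟩ := h
    have e1 := (iso_meridian_layer ε h1).append_right h2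
    have e2 := (ih h2).append_left (isTangle_singleton.2 h1)
    exact Iso.trans (by simpa using e1) (by simpa using e2)

/-- The diagram `d` with a meridian around it. -/
def Diagram.meridian (ε : Bool) (d : Diagram) : Diagram :=
  ⟨d.base, meridianWord ε d.base.length ++ d.word,
    (isTangle_meridianWord ε d.base).append d.isTangle⟩

theorem annulusRel_meridian (ε : Bool) :
    annulusRel ≤ annulusRel.comap (Finsupp.lmapDomain Scalar Scalar (Diagram.meridian ε)) := by
  intro x hx
  change x.mapDomain (Diagram.meridian ε) ∈ annulusRel
  refine mapDomain_mem_of_span (S := annulusSet) _ ?_ hx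
  rintro _ (⟨a, r, hr, rfl⟩ | ⟨a, b, f, g, rfl⟩)
  · refine Submodule.subset_span (Or.inl ⟨a, _,
      rectSet_context (fun t : Tangle a a => (⟨meridianWord ε a.length ++ t.word,
        (isTangle_meridianWord ε a).append t.isTangle⟩ : Tangle a a)) [] []
        (meridianWord ε a.length) [] (by simpa using isTangle_meridianWord ε a)
        (by simp [IsTangle]) (fun t => by simp) hr, ?_⟩)
    rw [← Finsupp.mapDomain_comp, ← Finsupp.mapDomain_comp]
    rfl
  · rw [mapDomain_single_sub]
    have e1 := ((iso_meridian ε f.isTangle).append_right g.isTangle).close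
    have e2 := closedIso_rotate f.isTangle ((isTangle_meridianWord ε b).append g.isTangle)
    have := e1.trans (by simpa using e2)
    simpa [ClosedIso, Diagram.meridian, Tangle.comp, Tangle.close] using this

/-! ### The algebras -/

/-- The skein of the rectangle with boundary `a` at the bottom and at the top. -/
def RectSkein (a : Obj) : Type := (Tangle a a →₀ Scalar) ⧸ rectRel a a

instance (a : Obj) : Ring (RectSkein a) := quotRing (rectRel_isIdeal a)

instance (a : Obj) : Module Scalar (RectSkein a) :=
  inferInstanceAs (Module Scalar ((Tangle a a →₀ Scalar) ⧸ rectRel a a))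

/-- The skein `𝒞` of the annulus. -/
def Annulus : Type := (Diagram →₀ Scalar) ⧸ annulusRel

instance : Ring Annulus := quotRing annulusRel_isIdeal

instance : Module Scalar Annulus :=
  inferInstanceAs (Module Scalar ((Diagram →₀ Scalar) ⧸ annulusRel))

/-- The class of a diagram in the rectangle. -/
def Tangle.toSkein {a : Obj} (f : Tangle a a) : RectSkein a := (rectRel a a).mkQ (Finsupp.single f 1)

/-- The class of a diagram in the annulus. -/
def Diagram.toSkein (d : Diagram) : Annulus := annulusRel.mkQ (Finsupp.single d 1)

/-- The linear map induced by closing diagrams in the rectangle. -/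
def closure (a : Obj) : RectSkein a →ₗ[Scalar] Annulus :=
  Submodule.mapQ (rectRel a a) annulusRel (Finsupp.lmapDomain Scalar Scalar Tangle.close)
    fun _ hx => mapDomain_mem_of_span (S := rectSet a a) _
      (fun r hr => Submodule.subset_span (Or.inl ⟨a, r, hr, rfl⟩)) hx

/-- The linear map induced by putting a meridian around diagrams in the annulus. -/
def meridianMap (ε : Bool) : Annulus →ₗ[Scalar] Annulus :=
  Submodule.mapQ annulusRel annulusRel (Finsupp.lmapDomain Scalar Scalar (Diagram.meridian ε))
    (annulusRel_meridian ε)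

/-- The meridian map `φ`: the meridian has linking number `+1` with an upward strand. -/
def phi : Annulus →ₗ[Scalar] Annulus := meridianMap false

/-- The meridian map `φ̄` with the reversed meridian. -/
def phiBar : Annulus →ₗ[Scalar] Annulus := meridianMap true

def deltaPhi (Q : Annulus) : Annulus := phi Q - δ • Q

def deltaPhiBar (Q : Annulus) : Annulus := phiBar Q - δ • Q

/-! ### Braids and their closures -/

/-- The boundary of `m`-braids. -/
abbrev up (m : ℕ) : Obj := List.replicate m true

/-- The Hecke algebra `H_m`, as the skein of the rectangle with `m` parallel strands. -/
abbrev Hecke (m : ℕ) : Type := RectSkein (up m)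

theorem isTangle_sigma (o : Bool) {m k : ℕ} (h : k + 1 < m) :
    IsTangle (up m) [(k, .cross o)] (up m) := by
  obtain ⟨n, rfl⟩ : ∃ n, m = k + 2 + n := ⟨m - (k + 2), by omega⟩
  refine isTangle_singleton.2 ⟨up k, up n, [true, true], [true, true], by simp,
    ⟨true, true, rfl, rfl⟩, ?_, ?_⟩ <;>
  simp only [up, List.replicate_add] <;> rfl

/-- For `o = true` the positive elementary braid that exchanges the strands at the positions
`k` and `k + 1` (counted from `0`, so this is `σ_{k+1}`), for `o = false` its inverse,
with the junk value `1` if there are no such strands. -/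
def sigma (m : ℕ) (o : Bool) (k : ℕ) : Hecke m :=
  if h : k + 1 < m then Tangle.toSkein ⟨[(k, .cross o)], isTangle_sigma o h⟩ else 1

/-- `A_{i,j}`, the closure of the `(i + j + 1)`-braid
`σ_{i+j} ⋯ σ_{j+2} σ_{j+1} σ_j⁻¹ ⋯ σ_2⁻¹ σ_1⁻¹`. -/
def braidA (i j : ℕ) : Annulus :=
  closure (up (i + j + 1))
    (((List.range i).reverse.map fun k => sigma (i + j + 1) true (j + k)).prod *
      ((List.range j).reverse.map fun k => sigma (i + j + 1) false k).prod)

/-- `A_m`, the closure of `σ_{m-1} ⋯ σ_2 σ_1`. -/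
def A (m : ℕ) : Annulus :=
  closure (up m) ((List.range (m - 1)).reverse.map fun k => sigma m true k).prod

/-- The mirror image of `A_m`, the closure of `σ_{m-1}⁻¹ ⋯ σ_2⁻¹ σ_1⁻¹`. -/
def ABar (m : ℕ) : Annulus :=
  closure (up m) ((List.range (m - 1)).reverse.map fun k => sigma m false k).prod

/-- `X_m = ∑_{j=0}^{m-1} A_{m-1-j,j}`. -/
def X (m : ℕ) : Annulus := ∑ j ∈ Finset.range m, braidA (m - 1 - j) j

/-! ### Symmetric functions -/

/-- The number of `j > i` with `π j < π i`. -/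
def code {m : ℕ} (π : Equiv.Perm (Fin m)) (i : Fin m) : ℕ :=
  (Finset.univ.filter fun j => i < j ∧ π j < π i).card

/-- The length `l(π)`, which is the number of inversions. -/
def permLength {m : ℕ} (π : Equiv.Perm (Fin m)) : ℕ :=
  (Finset.univ.filter fun p : Fin m × Fin m => p.1 < p.2 ∧ π p.2 < π p.1).card

/-- A reduced word for `π` in the transpositions `s_k = (k, k + 1)`, `k ≥ 0`:
the product over `i = 0, 1, …` of `s_{i+c-1} ⋯ s_{i+1} s_i` with `c = code π i`. -/
def permWord {m : ℕ} (π : Equiv.Perm (Fin m)) : List ℕ :=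
  (List.finRange m).flatMap fun i => (List.range (code π i)).reverse.map fun k => (i : ℕ) + k

/-- The positive permutation braid `ω_π`. -/
def permBraid {m : ℕ} (π : Equiv.Perm (Fin m)) : Hecke m :=
  ((permWord π).map (sigma m true)).prod

/-- `a_m = ∑_π s ^ l(π) ω_π`. -/
def quasiIdem (m : ℕ) : Hecke m :=
  ∑ π : Equiv.Perm (Fin m), ((s ^ permLength π : Scalarˣ) : Scalar) • permBraid π

/-- The scalar `α_m` with `a_m a_m = α_m a_m`. -/
def alpha (m : ℕ) : Scalarˣ :=
  Classical.epsilon fun α : Scalarˣ => quasiIdem m * quasiIdem m = (α : Scalar) • quasiIdem m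

/-- The complete symmetric function `h_m`, the closure of `a_m / α_m`. -/
def hComplete (m : ℕ) : Annulus :=
  closure (up m) ((((alpha m)⁻¹ : Scalarˣ) : Scalar) • quasiIdem m)

/-- The power sum `P_m`: Newton's relation `ln H(t) = ∑ P_m t ^ m / m` with
`H(t) = 1 + ∑ h_m t ^ m`, differentiated and multiplied by `t H(t)`, says
`m h_m = P_m + ∑_{0 < r < m} P_r h_{m-r}`, and it is solved for `P_m` here (and gives `P_0 = 0`). -/
def powerSum (m : ℕ) : Annulus :=
  m • hComplete m - ∑ r : Fin m, powerSum r * hComplete (m - r)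
termination_by m
decreasing_by exact r.2

end

end HomflySkein

/-! There are two independent halves.

Meridians. After closing, a meridian acts on the closure of `x` as multiplication of `x` in `H_m` by
the class of the encircled strands (`meridianMap_closure`). Apply the skein relation at a crossing
of the meridian with an outermost strand where the two run parallel. Switching the crossing frees
that strand from the meridian; smoothing it merges strand and meridian into a single strand that
runs around the remaining ones and carries one curl. Iteration gives `δ` plus `z v⁻¹` times a sum of
Jucys-Murphy braids, and for the reversed meridian `δ` minus `z v` times a sum of inverses of such
braids (`cls_meridian_false`, `cls_meridian_true`). Multiplied by the cycle that closes to `Ā_m` or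
`A_m`, each summand becomes, up to conjugation inside the closure, the braid of one `A_{i,j}`
(`IsBraid.trace_asc_desc`, `IsBraid.trace_desc_asc_inv`). Hence both `Δ`'s are multiples of `X_m`.

Power sums. Put `A(t) = 1 + z ∑ A_m t^m`, `B(t) = 1 - z ∑ Ā_m t^m`, `H(t) = ∑ h_m t^m`, `P(t) = ∑
P_m t^m`. Changing one crossing gives `A_{i+1,j} = A_{i,j+1} + z Ā_{j+1} A_{i+1}`
(`braidA_succ_left`); telescoping yields `B A = 1` and, after summing over `j`, `z ∑ X_m t^m = B · t
A'`. Expanding the symmetrizer along its first strand gives `(1 + s² + ⋯ + s^(2(m-1))) h_m = ∑ s^r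
A_{r+1} h_{m-1-r}` (`qNum_smul_hComplete`), which says `H(st) = A(t) H(s⁻¹t)`. The logarithmic
derivative of this identity is `P(st) - P(s⁻¹t) = t A' / A = B · t A'`, and its coefficients are
`{m} P_m = z X_m`. The division of series takes place in the subalgebra generated by the `A_m`,
which is commutative because two adjacent closed cycles can be exchanged by conjugation
(`A_mul_A_comm`). -/

namespace HomflySkein

section Braid

/-! ### Ascending and descending products -/

/-- `f p * f (p + 1) * ⋯ * f (p + n - 1)`. -/
def asc {M : Type*} [Monoid M] (f : ℕ → M) : ℕ → ℕ → M
  | _, 0 => 1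
  | p, n + 1 => f p * asc f (p + 1) n

/-- `f (p + n - 1) * ⋯ * f (p + 1) * f p`. -/
def desc {M : Type*} [Monoid M] (f : ℕ → M) : ℕ → ℕ → M
  | _, 0 => 1
  | p, n + 1 => desc f (p + 1) n * f p

section Monoid

variable {M : Type*} [Monoid M] (f : ℕ → M)

@[simp] theorem asc_zero (p : ℕ) : asc f p 0 = 1 := rfl

@[simp] theorem desc_zero (p : ℕ) : desc f p 0 = 1 := rfl

theorem asc_succ (p n : ℕ) : asc f p (n + 1) = f p * asc f (p + 1) n := rfl

theorem desc_succ (p n : ℕ) : desc f p (n + 1) = desc f (p + 1) n * f p := rfl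

theorem asc_add (p m n : ℕ) : asc f p (m + n) = asc f p m * asc f (p + m) n := by
  induction m generalizing p with
  | zero => simp
  | succ m ih => rw [add_right_comm, asc_succ, asc_succ, ih, mul_assoc, add_right_comm, add_assoc p]

theorem desc_add (p m n : ℕ) : desc f p (m + n) = desc f (p + m) n * desc f p m := by
  induction m generalizing p with
  | zero => simp
  | succ m ih => rw [add_right_comm, desc_succ, desc_succ, ih, mul_assoc, add_right_comm, add_assoc p]

theorem asc_succ' (p n : ℕ) : asc f p (n + 1) = asc f p n * f (p + n) := by
  rw [asc_add, asc_succ, asc_zero, mul_one]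

theorem desc_succ' (p n : ℕ) : desc f p (n + 1) = f (p + n) * desc f p n := by
  rw [desc_add, desc_succ, desc_zero, one_mul]

variable {f}

theorem commute_asc {x : M} {p n : ℕ} (h : ∀ k, p ≤ k → k < p + n → Commute x (f k)) :
    Commute x (asc f p n) := by
  induction n generalizing p with
  | zero => exact Commute.one_right x
  | succ n ih =>
    exact (h p le_rfl (by omega)).mul_right (ih fun k h1 h2 => h k (by omega) (by omega))

theorem commute_desc {x : M} {p n : ℕ} (h : ∀ k, p ≤ k → k < p + n → Commute x (f k)) :
    Commute x (desc f p n) := by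
  induction n generalizing p with
  | zero => exact Commute.one_right x
  | succ n ih =>
    exact (ih fun k h1 h2 => h k (by omega) (by omega)).mul_right (h p le_rfl (by omega))

theorem map_asc {K F : Type*} [Monoid K] [FunLike F M K] [MonoidHomClass F M K] (φ : F) (f : ℕ → M)
    (p n : ℕ) : φ (asc f p n) = asc (fun k => φ (f k)) p n := by
  induction n generalizing p with
  | zero => simp
  | succ n ih => simp [asc_succ, ih]

theorem map_desc {K F : Type*} [Monoid K] [FunLike F M K] [MonoidHomClass F M K] (φ : F)
    (f : ℕ → M) (p n : ℕ) : φ (desc f p n) = desc (fun k => φ (f k)) p n := by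
  induction n generalizing p with
  | zero => simp
  | succ n ih => simp [desc_succ, ih]

/-- The substitution reverses the interval from `p` to `p + n - 1` onto the one from `t` to `t + n -
1`; on this range the subtraction is never truncated. -/
theorem asc_eq_desc_reflect (f : ℕ → M) (p n t : ℕ) :
    asc (fun k => f (p + n + t - 1 - k)) p n = desc f t n := by
  induction n generalizing p with
  | zero => simp
  | succ n ih =>
    rw [asc_succ, desc_succ', ← ih (p + 1)]
    have e : p + (n + 1) + t - 1 - p = t + n := by omega
    have e' : p + 1 + n + t = p + (n + 1) + t := by omega
    rw [e, e']

theorem desc_eq_asc_reflect (f : ℕ → M) (p n t : ℕ) :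
    desc (fun k => f (p + n + t - 1 - k)) p n = asc f t n := by
  induction n generalizing p with
  | zero => simp
  | succ n ih =>
    rw [desc_succ, asc_succ', ← ih (p + 1)]
    have e : p + (n + 1) + t - 1 - p = t + n := by omega
    have e' : p + 1 + n + t = p + (n + 1) + t := by omega
    rw [e, e']

/-- The elements `f 0, …, f (N - 1)` satisfy the braid relations. -/
structure IsBraid (f : ℕ → M) (N : ℕ) : Prop where
  comm : ∀ k l, k + 2 ≤ l → l < N → Commute (f k) (f l)
  braid : ∀ k, k + 1 < N → f k * f (k + 1) * f k = f (k + 1) * f k * f (k + 1)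

theorem IsBraid.reflect {N : ℕ} (h : IsBraid f N) : IsBraid (fun k => f (N - 1 - k)) N where
  comm k l h1 h2 := (h.comm _ _ (by omega) (by omega)).symm
  braid k hk := by
    have e : N - 1 - k = N - 1 - (k + 1) + 1 := by omega
    rw [e]
    exact (h.braid _ (by omega)).symm

variable {N : ℕ} (hf : IsBraid f N)
include hf

theorem IsBraid.commute {k l : ℕ} (h : k + 2 ≤ l ∨ l + 2 ≤ k) (hk : k < N) (hl : l < N) :
    Commute (f k) (f l) := by
  rcases h with h | h
  · exact hf.comm _ _ h hl
  · exact (hf.comm _ _ h hk).symm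

/-- Conjugation by a cycle raises the index of a generator by one. All factors except `f k` and `f
(k + 1)` are passed by far commutation, and those two by the braid relation. -/
theorem IsBraid.asc_mul {p n k : ℕ} (h1 : p ≤ k) (h2 : k < p + n) (h3 : p + n < N) :
    asc f p (n + 1) * f k = f (k + 1) * asc f p (n + 1) := by
  obtain ⟨a, rfl⟩ := Nat.exists_eq_add_of_le h1
  obtain ⟨b, rfl⟩ : ∃ b, n = a + 1 + b := ⟨n - a - 1, by omega⟩
  have e : asc f p (a + 1 + b + 1) =
      asc f p a * (f (p + a) * f (p + a + 1)) * asc f (p + a + 2) b := by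
    rw [show a + 1 + b + 1 = a + (b + 2) by omega, asc_add, asc_succ, asc_succ]
    simp only [mul_assoc, add_assoc]
  have c1 : Commute (f (p + a)) (asc f (p + a + 2) b) :=
    commute_asc fun k _ _ => hf.commute (by omega) (by omega) (by omega)
  have c2 : Commute (f (p + a + 1)) (asc f p a) :=
    commute_asc fun k _ _ => hf.commute (by omega) (by omega) (by omega)
  have br := hf.braid (p + a) (by omega)
  calc asc f p (a + 1 + b + 1) * f (p + a)
      = asc f p a * (f (p + a) * f (p + a + 1)) * (asc f (p + a + 2) b * f (p + a)) := by
        rw [e, mul_assoc]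
    _ = asc f p a * (f (p + a) * f (p + a + 1) * f (p + a)) * asc f (p + a + 2) b := by
        rw [← c1.eq]; simp only [mul_assoc]
    _ = (asc f p a * f (p + a + 1)) * (f (p + a) * f (p + a + 1)) * asc f (p + a + 2) b := by
        rw [br]; simp only [mul_assoc]
    _ = f (p + a + 1) * asc f p (a + 1 + b + 1) := by
        rw [← c2.eq, e]; simp only [mul_assoc]

theorem IsBraid.asc_mul_asc {p q n j : ℕ} (h1 : p ≤ q) (h2 : q + j ≤ p + n) (h3 : p + n < N) :
    asc f p (n + 1) * asc f q j = asc f (q + 1) j * asc f p (n + 1) := by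
  induction j generalizing q with
  | zero => simp
  | succ j ih =>
    rw [asc_succ _ q, asc_succ _ (q + 1), ← mul_assoc, hf.asc_mul h1 (by omega) h3, mul_assoc,
      ih (by omega) (by omega), mul_assoc]

theorem IsBraid.asc_mul_desc {p q n j : ℕ} (h1 : p ≤ q) (h2 : q + j ≤ p + n) (h3 : p + n < N) :
    asc f p (n + 1) * desc f q j = desc f (q + 1) j * asc f p (n + 1) := by
  induction j generalizing q with
  | zero => simp
  | succ j ih =>
    rw [desc_succ, desc_succ, ← mul_assoc, ih (by omega) (by omega), mul_assoc,
      hf.asc_mul h1 (by omega) h3, mul_assoc]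

/-- The shift of `asc_mul` ends at the last generator. The square of the full cycle carries the last
generator around to the first one, so generators behave as if indexed cyclically, with one missing
index that takes an extra turn. -/
theorem IsBraid.asc_sq_mul {n : ℕ} (h : n < N) :
    asc f 0 (n + 1) * asc f 0 (n + 1) * f n = f 0 * (asc f 0 (n + 1) * asc f 0 (n + 1)) := by
  have e1 : asc f 0 (n + 1) = asc f 0 n * f n := by rw [asc_succ', zero_add]
  have e2 := hf.asc_mul_asc (p := 0) (q := 0) (n := n) (j := n) le_rfl (by omega) (by omega)
  have e3 : asc f 0 (n + 1) * asc f 0 (n + 1) = f 0 * (asc f 0 (n + 1) * asc f 0 n) := by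
    rw [e2, ← mul_assoc, zero_add, ← zero_add 1, ← asc_succ]
  calc asc f 0 (n + 1) * asc f 0 (n + 1) * f n
      = f 0 * (asc f 0 (n + 1) * (asc f 0 n * f n)) := by rw [e3]; simp only [mul_assoc]
    _ = f 0 * (asc f 0 (n + 1) * asc f 0 (n + 1)) := by rw [← e1]

end Monoid

/-! ### Conjugation identities under a trace -/

section Group

variable {G X : Type*} [Group G] {f : ℕ → G} {N : ℕ} (hf : IsBraid f N) {τ : G → X}
  (hτ : ∀ x y, τ (x * y) = τ (y * x))
include hf hτ

/-- Conjugating the descending cycle by the ascending one does not change the trace, even in the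
presence of a factor `Z` that need not commute with `f p`. This allows `Z` to be a cycle on the
strands to the left that shares one strand with this block. -/
theorem IsBraid.trace_asc_desc {p n : ℕ} (h : p + n ≤ N) {Z : G}
    (hZ : ∀ k, p < k → k < p + n → Commute Z (f k)) :
    τ (asc f p n * desc f p n * (asc f p n)⁻¹ * Z) = τ (desc f p n * Z) := by
  induction n generalizing p Z with
  | zero => simp
  | succ n ih =>
    have hR : asc f p (n + 1) = f p * asc f (p + 1) n := asc_succ f p n
    have hR' : asc f p (n + 1) = asc f p n * f (p + n) := asc_succ' f p n
    have hU : desc f p (n + 1) = desc f (p + 1) n * f p := desc_succ f p n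
    have hU' : desc f p (n + 1) = f (p + n) * desc f p n := desc_succ' f p n
    have e1 : asc f p (n + 1) * asc f p n = asc f (p + 1) n * asc f p (n + 1) :=
      hf.asc_mul_asc le_rfl le_rfl (by omega)
    have e2 : asc f p (n + 1) * desc f p n = desc f (p + 1) n * asc f p (n + 1) :=
      hf.asc_mul_desc le_rfl le_rfl (by omega)
    have cA : Commute Z (asc f (p + 1) n) :=
      commute_asc fun k h1 h2 => hZ k (by omega) (by omega)
    have cD : Commute Z (desc f (p + 1) n) :=
      commute_desc fun k h1 h2 => hZ k (by omega) (by omega)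
    -- Both shift relations are used with the long cycle `R`: the first assembles a second copy of
    -- `R`, the second moves that copy to the right, where it cancels.
    have e3 : asc f p (n + 1) * desc f p (n + 1) * (asc f p (n + 1))⁻¹ =
        (asc f (p + 1) n)⁻¹ * (f p * (asc f (p + 1) n * desc f (p + 1) n)) := by
      rw [mul_inv_eq_iff_eq_mul, mul_assoc _⁻¹, eq_inv_mul_iff_mul_eq]
      calc asc f (p + 1) n * (asc f p (n + 1) * desc f p (n + 1))
          = asc f p (n + 1) * (asc f p n * f (p + n)) * desc f p n := by
            rw [hU']; simp only [← mul_assoc]; rw [e1]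
        _ = asc f p (n + 1) * (asc f p (n + 1) * desc f p n) := by rw [← hR', mul_assoc]
        _ = _ := by rw [e2]; nth_rw 1 [hR]; simp only [mul_assoc]
    have e4 : asc f (p + 1) n * desc f (p + 1) n * Z * (asc f (p + 1) n)⁻¹ =
        asc f (p + 1) n * desc f (p + 1) n * (asc f (p + 1) n)⁻¹ * Z := by
      rw [mul_assoc _ Z, cA.inv_right.eq, mul_assoc _ _ Z]
    -- Once `(asc f (p + 1) n)⁻¹` has gone around the trace and past `Z`, the same expression is
    -- left for the shorter block, with `Z * f p` in the role of `Z`.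
    have hZ' : ∀ k, p + 1 < k → k < p + 1 + n → Commute (Z * f p) (f k) := fun k h1 h2 =>
      (hZ k (by omega) (by omega)).mul_left (hf.commute (by omega) (by omega) (by omega))
    calc τ (asc f p (n + 1) * desc f p (n + 1) * (asc f p (n + 1))⁻¹ * Z)
        = τ (f p * (asc f (p + 1) n * desc f (p + 1) n * Z * (asc f (p + 1) n)⁻¹)) := by
          rw [e3, mul_assoc, hτ]; simp only [mul_assoc]
      _ = τ (asc f (p + 1) n * desc f (p + 1) n * (asc f (p + 1) n)⁻¹ * (Z * f p)) := by
          rw [e4, hτ, mul_assoc _ Z]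
      _ = τ (desc f (p + 1) n * (Z * f p)) := ih (by omega) hZ'
      _ = τ (Z * (desc f (p + 1) n * f p)) := by rw [← mul_assoc, ← cD.eq, mul_assoc]
      _ = τ (desc f p (n + 1) * Z) := by rw [hτ, hU]

/-- This is `trace_asc_desc` for the reflected generators `f (n - 1 - k)`, which exchange `asc` and
`desc`, and for the trace `x ↦ τ x⁻¹`. -/
theorem IsBraid.trace_desc_asc_inv {n : ℕ} (h : n ≤ N) {Z : G}
    (hZ : ∀ k, k + 1 < n → Commute Z (f k)) :
    τ (desc f 0 n * (asc f 0 n)⁻¹ * (desc f 0 n)⁻¹ * Z) = τ ((asc f 0 n)⁻¹ * Z) := by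
  have hg : IsBraid f n :=
    ⟨fun k l h1 h2 => hf.comm k l h1 (by omega), fun k h1 => hf.braid k (by omega)⟩
  have hσ : ∀ x y : G, τ (x * y)⁻¹ = τ (y * x)⁻¹ := fun x y => by simp only [mul_inv_rev, hτ]
  have key := hg.reflect.trace_asc_desc (τ := fun x => τ x⁻¹) hσ (p := 0) (n := n) (by omega)
    (Z := Z⁻¹) (fun k h1 h2 => (hZ _ (by omega)).inv_left)
  have e1 := asc_eq_desc_reflect f 0 n 0
  have e2 := desc_eq_asc_reflect f 0 n 0
  simp only [zero_add, add_zero] at e1 e2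
  rw [e1, e2] at key
  simp only [mul_inv_rev, inv_inv] at key
  rw [hτ, hτ _ Z, ← key]
  simp only [mul_assoc]

/-- The closures of two full cycles on adjacent blocks of strands commute. -/
theorem IsBraid.trace_desc_mul_desc {i j : ℕ} (h : i + j + 1 = N) :
    τ (desc f 0 i * desc f (i + 1) j) = τ (desc f 0 j * desc f (j + 1) i) := by
  subst h
  set R := asc f 0 (i + j + 1) with hR
  -- Conjugation by `R ^ (j + 1)` rotates all `i + j + 2` strands by `j + 1` places and so exchanges
  -- the two blocks.
  have low : ∀ t k, k + t < i + j + 1 → R ^ t * f k = f (k + t) * R ^ t := by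
    intro t
    induction t with
    | zero => simp
    | succ t ih =>
      intro k hk
      rw [pow_succ, mul_assoc, hR, hf.asc_mul (by omega) (by omega) (by omega), ← hR, ← mul_assoc,
        ih _ (by omega), mul_assoc, add_right_comm, add_assoc]
  -- A generator of the right block climbs to the last index in `j - 1 - k` steps, wraps around to
  -- `0` in two, and climbs to `k` in `k` more: `j + 1` in all.
  have high : ∀ k, k < j → R ^ (j + 1) * f (i + 1 + k) = f k * R ^ (j + 1) := by
    intro k hk
    have e : j + 1 = k + 2 + (j - 1 - k) := by omega
    have e1 := low (j - 1 - k) (i + 1 + k) (by omega)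
    have e2 : R ^ 2 * f (i + j) = f 0 * R ^ 2 := by
      rw [sq]; exact hf.asc_sq_mul (by omega)
    have e3 := low k 0 (by omega)
    have e4 : i + 1 + k + (j - 1 - k) = i + j := by omega
    rw [e4] at e1
    rw [zero_add] at e3
    rw [e, pow_add, pow_add, mul_assoc, e1, ← mul_assoc, mul_assoc (R ^ k), e2, ← mul_assoc, e3]
    simp only [mul_assoc]
  have hlow : ∀ n k, k + n + (j + 1) ≤ i + j + 1 →
      R ^ (j + 1) * desc f k n = desc f (k + (j + 1)) n * R ^ (j + 1) := by
    intro n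
    induction n with
    | zero => simp
    | succ n ih =>
      intro k hk
      rw [desc_succ, desc_succ, ← mul_assoc, ih _ (by omega), mul_assoc, low _ _ (by omega),
        mul_assoc, add_right_comm]
  have hhigh : ∀ n k, k + n ≤ j →
      R ^ (j + 1) * desc f (i + 1 + k) n = desc f k n * R ^ (j + 1) := by
    intro n
    induction n with
    | zero => simp
    | succ n ih =>
      intro k hk
      rw [desc_succ, desc_succ, ← mul_assoc, add_assoc _ k, ih _ (by omega), mul_assoc,
        high _ (by omega), mul_assoc]
  have e1 := hlow i 0 (by omega)
  have e2 := hhigh j 0 (by omega)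
  rw [zero_add] at e1
  rw [add_zero] at e2
  have e3 : desc f 0 i * desc f (i + 1) j =
      (R ^ (j + 1))⁻¹ * (desc f (j + 1) i * desc f 0 j * R ^ (j + 1)) := by
    rw [eq_inv_mul_iff_mul_eq, ← mul_assoc, e1, mul_assoc, e2, mul_assoc]
  rw [e3, hτ, mul_assoc, mul_inv_cancel, mul_one, hτ]

end Group

end Braid

noncomputable section

open MulOpposite

section Symmetrizer

/-! ### The symmetrizer of the Hecke algebra -/

theorem asc_op {M : Type*} [Monoid M] (f : ℕ → M) (p n : ℕ) :
    asc (fun k => op (f k)) p n = op (desc f p n) := by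
  induction n generalizing p with
  | zero => simp
  | succ n ih => rw [asc_succ, desc_succ, ih, op_mul]

theorem IsBraid.op {M : Type*} [Monoid M] {f : ℕ → M} {N : ℕ} (hf : IsBraid f N) :
    IsBraid (fun k => op (f k)) N where
  comm k l h1 h2 := (hf.comm k l h1 h2).op
  braid k h := by
    simp only [← op_mul, ← mul_assoc, hf.braid k h]

theorem IsBraid.mul_desc {M : Type*} [Monoid M] {f : ℕ → M} {N : ℕ} (hf : IsBraid f N)
    {p n k : ℕ} (h1 : p ≤ k) (h2 : k < p + n) (h3 : p + n < N) :
    f k * desc f p (n + 1) = desc f p (n + 1) * f (k + 1) := by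
  have := hf.op.asc_mul h1 h2 h3
  rw [asc_op, ← op_mul, ← op_mul] at this
  exact op_injective this

variable {R : Type*} [Ring R] [Algebra Scalar R]

/-- The braid relations together with the quadratic relations of the Hecke algebra. -/
structure IsHecke (f : ℕ → R) (N : ℕ) : Prop extends IsBraid f N where
  quad : ∀ k, k < N → f k * f k = (z : Scalar) • f k + 1

/-- The sum of `s ^ l(π) ω_π` over all permutations of the strands `p, …, p + n - 1`. -/
def sym (f : ℕ → R) : ℕ → ℕ → R
  | _, 0 => 1
  | p, n + 1 => (∑ c ∈ Finset.range (n + 1), (s : Scalar) ^ c • desc f p c) * sym f (p + 1) n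

/-- `sym` with reversed products. -/
def symRev (f : ℕ → R) : ℕ → ℕ → R
  | _, 0 => 1
  | p, n + 1 => symRev f (p + 1) n * (∑ c ∈ Finset.range (n + 1), (s : Scalar) ^ c • asc f p c)

theorem val_z : (z : Scalar) = (s : Scalar) - ((s⁻¹ : Scalarˣ) : Scalar) := by
  change brace 1 = _
  simp [brace]

theorem IsHecke.op {f : ℕ → R} {N : ℕ} (hf : IsHecke f N) : IsHecke (fun k => op (f k)) N where
  toIsBraid := hf.toIsBraid.op
  quad k hk := by rw [← op_mul, hf.quad k hk, op_add, op_smul, op_one]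

theorem sym_op (f : ℕ → R) (p n : ℕ) : sym (fun k => op (f k)) p n = op (symRev f p n) := by
  induction n generalizing p with
  | zero => rfl
  | succ n ih =>
    have : ∀ c, desc (fun k => op (f k)) p c = op (asc f p c) := fun c => by
      induction c generalizing p with
      | zero => simp
      | succ n ih => rw [desc_succ, asc_succ, ih, op_mul]
    simp only [sym, symRev, ih, this, op_mul, Finset.op_sum, op_smul]

/-- Each crossing is absorbed by the symmetrizer with eigenvalue `s`, one of the two roots of the
quadratic relation. -/
theorem IsHecke.mul_sym {f : ℕ → R} {N : ℕ} (hf : IsHecke f N) {p n k : ℕ} (h : p + n ≤ N + 1)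
    (h1 : p ≤ k) (h2 : k + 1 < p + n) : f k * sym f p n = (s : Scalar) • sym f p n := by
  induction n generalizing p k with
  | zero => omega
  | succ n ih =>
    obtain ⟨a, rfl⟩ := Nat.exists_eq_add_of_le h1
    have hE : ∀ l, p + 1 ≤ l → l + 1 < p + 1 + n →
        f l * sym f (p + 1) n = (s : Scalar) • sym f (p + 1) n :=
      fun l h3 h4 => ih (by omega) h3 h4
    rw [← sub_eq_zero]
    have e : f (p + a) * sym f p (n + 1) - (s : Scalar) • sym f p (n + 1) =
        ∑ c ∈ Finset.range (n + 1), (s : Scalar) ^ c •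
          (f (p + a) * desc f p c * sym f (p + 1) n -
            (s : Scalar) • (desc f p c * sym f (p + 1) n)) := by
      simp only [sym, Finset.sum_mul, Finset.mul_sum, Finset.smul_sum, ← Finset.sum_sub_distrib,
        smul_sub, mul_smul_comm, smul_mul_assoc, ← mul_assoc, smul_comm (s : Scalar)]
    -- With `k = p + a`, multiplication by `f k` mixes only the terms `c = a` and `c = a + 1`, and
    -- these cancel since `s z = s² - 1`. In every other term `f k` passes `desc f p c`, keeping its
    -- index for `c < a` and raising it for `c > a + 1`, and the inductive hypothesis applies.
    rw [e, Finset.sum_eq_add a (a + 1) (by omega)]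
    · have e1 : f (p + a) * desc f p a = desc f p (a + 1) := (desc_succ' f p a).symm
      have e2 : f (p + a) * desc f p (a + 1) = (z : Scalar) • desc f p (a + 1) + desc f p a := by
        rw [← e1, ← mul_assoc, hf.quad _ (by omega), add_mul, smul_mul_assoc, one_mul]
      have e3 : (s : Scalar) * (z : Scalar) = (s : Scalar) * (s : Scalar) - 1 := by
        rw [val_z, mul_sub, Units.mul_inv]
      rw [e1, e2, add_mul, smul_mul_assoc]
      generalize desc f p (a + 1) * sym f (p + 1) n = x
      generalize desc f p a * sym f (p + 1) n = y
      have e4 : (s : Scalar) ^ (a + 1) • (z : Scalar) • x =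
          (s : Scalar) ^ (a + 2) • x - (s : Scalar) ^ a • x := by
        rw [smul_smul, pow_succ, mul_assoc, e3, ← sub_smul]
        congr 1; ring
      rw [smul_sub, smul_sub, smul_add, e4, smul_smul, smul_smul, ← pow_succ, ← pow_succ]
      abel
    · intro c hc hca
      rw [Finset.mem_range] at hc
      rw [sub_eq_zero.2, smul_zero]
      rcases lt_or_gt_of_ne hca.1 with h3 | h3
      · have := commute_desc (f := f) (x := f (p + a)) (p := p) (n := c) fun l h4 h5 =>
          hf.commute (by omega) (by omega) (by omega)
        rw [this.eq, mul_assoc, hE _ (by omega) (by omega), mul_smul_comm]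
      · obtain ⟨d, rfl⟩ : ∃ d, c = d + 1 := ⟨c - 1, by omega⟩
        rw [hf.mul_desc (by omega) (by omega) (by omega), mul_assoc, hE _ (by omega) (by omega),
          mul_smul_comm]
    · intro hc; simp at hc; omega
    · intro hc; simp at hc; omega

theorem commute_sym {f : ℕ → R} {x : R} {p n : ℕ}
    (h : ∀ k, p ≤ k → k + 1 < p + n → Commute x (f k)) : Commute x (sym f p n) := by
  induction n generalizing p with
  | zero => exact Commute.one_right x
  | succ n ih =>
    refine Commute.mul_right (Commute.sum_right _ _ _ fun c hc => Commute.smul_right ?_ _)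
      (ih fun k h1 h2 => h k (by omega) (by omega))
    rw [Finset.mem_range] at hc
    exact commute_desc fun k h1 h2 => h k h1 (by omega)

/-- On such a `y` every generator acts as `s`, so the symmetrizer acts through its value under the
character that sends all generators to `s`; `sym_const` evaluates it. -/
theorem mul_sym_of_eigen {f : ℕ → R} {p n : ℕ} {y : R}
    (hy : ∀ k, p ≤ k → k + 1 < p + n → y * f k = (s : Scalar) • y) :
    y * sym f p n = sym (fun _ => (s : Scalar)) p n • y := by
  induction n generalizing p with
  | zero => simp [sym]
  | succ n ih =>
    have hd : ∀ c < n + 1, y * desc f p c = desc (fun _ => (s : Scalar)) p c • y := by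
      intro c
      induction c with
      | zero => simp
      | succ c ihc =>
        intro hc
        rw [desc_succ', desc_succ', ← mul_assoc, hy _ (by omega) (by omega), smul_mul_assoc,
          ihc (by omega), smul_smul]
    have hs : y * ∑ c ∈ Finset.range (n + 1), (s : Scalar) ^ c • desc f p c =
        (∑ c ∈ Finset.range (n + 1), (s : Scalar) ^ c • desc (fun _ => (s : Scalar)) p c) • y := by
      rw [Finset.mul_sum, Finset.sum_smul]
      refine Finset.sum_congr rfl fun c hc => ?_
      rw [mul_smul_comm, hd c (Finset.mem_range.1 hc), smul_assoc]
    rw [sym, sym, ← mul_assoc, hs, smul_mul_assoc, ih fun k h1 h2 => hy k (by omega) (by omega),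
      smul_smul]

theorem desc_const (x : Scalar) (p n : ℕ) : desc (fun _ => x) p n = x ^ n := by
  induction n generalizing p with
  | zero => simp
  | succ n ih => rw [desc_succ, ih, pow_succ]

/-- `1 + s ^ 2 + ⋯ + s ^ (2 * (n - 1))`. -/
def qNum (n : ℕ) : Scalar := ∑ c ∈ Finset.range n, (s : Scalar) ^ (2 * c)

theorem z_mul_qNum (n : ℕ) : (z : Scalar) * qNum n = ((s⁻¹ : Scalarˣ) : Scalar) *
    ((s : Scalar) ^ (2 * n) - 1) := by
  have h : ((s⁻¹ : Scalarˣ) : Scalar) * (s : Scalar) = 1 := Units.inv_mul _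
  have := geom_sum_mul ((s : Scalar) ^ 2) n
  simp only [← pow_mul] at this
  rw [← this, qNum, val_z, ← sub_eq_zero]
  linear_combination (-(s : Scalar) * ∑ c ∈ Finset.range n, (s : Scalar) ^ (2 * c)) * h

theorem brace_eq (n : ℕ) : brace n = (s : Scalar) ^ n - ((s⁻¹ : Scalarˣ) : Scalar) ^ n := by
  simp [brace]

theorem brace_mul_pow (n : ℕ) :
    brace n * (s : Scalar) ^ n = (s : Scalar) ^ (2 * n) - 1 := by
  have h : ((s⁻¹ : Scalarˣ) : Scalar) * (s : Scalar) = 1 := Units.inv_mul _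
  rw [brace_eq, sub_mul, ← mul_pow _ _ n, ← mul_pow ((s⁻¹ : Scalarˣ) : Scalar), h, one_pow, two_mul,
    pow_add, mul_pow]

/-- Here the inverted scalars are needed: `z` times this number is `s ^ n` times `{n + 1}`. -/
theorem isUnit_qNum (n : ℕ) : IsUnit (qNum (n + 1)) := by
  have h : IsUnit ((z : Scalar) * qNum (n + 1)) := by
    rw [z_mul_qNum, ← brace_mul_pow]
    exact (Units.isUnit _).mul ((isUnit_brace (by omega)).mul ((Units.isUnit s).pow _))
  exact isUnit_of_mul_isUnit_right h

/-- The scalar `α` with `sym f p n * sym f p n = α • sym f p n`. -/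
def symScalar (n : ℕ) : Scalar := ∏ j ∈ Finset.range n, qNum (j + 1)

theorem isUnit_symScalar (n : ℕ) : IsUnit (symScalar n) :=
  IsUnit.prod_iff.2 fun j _ => isUnit_qNum j

theorem sym_const (p n : ℕ) : sym (fun _ => (s : Scalar)) p n = symScalar n := by
  induction n generalizing p with
  | zero => simp [sym, symScalar]
  | succ n ih =>
    rw [sym, ih, symScalar, symScalar, Finset.prod_range_succ, mul_comm, qNum]
    congr 1
    refine Finset.sum_congr rfl fun c _ => ?_
    rw [desc_const, smul_eq_mul, ← pow_add, two_mul]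

/-- `sym` absorbs crossings from the left and `symRev` from the right, so their product is the same
invertible scalar times either of them. It follows that `sym` absorbs crossings on both sides. -/
theorem IsHecke.symRev_eq_sym {f : ℕ → R} {N : ℕ} (hf : IsHecke f N) {p n : ℕ}
    (h : p + n ≤ N + 1) : symRev f p n = sym f p n := by
  have e1 : symRev f p n * sym f p n = symScalar n • symRev f p n := by
    rw [mul_sym_of_eigen, sym_const]
    intro k h1 h2
    apply op_injective
    rw [op_mul, op_smul, ← sym_op]
    exact hf.op.mul_sym h h1 h2
  have e2 : symRev f p n * sym f p n = symScalar n • sym f p n := by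
    apply op_injective
    rw [op_mul, op_smul, ← sym_op, mul_sym_of_eigen, sym_const]
    intro k h1 h2
    rw [← op_mul, hf.mul_sym h h1 h2, op_smul]
  exact (isUnit_symScalar n).smul_left_cancel.1 (e1.symm.trans e2)

theorem IsHecke.sym_mul {f : ℕ → R} {N : ℕ} (hf : IsHecke f N) {p n k : ℕ} (h : p + n ≤ N + 1)
    (h1 : p ≤ k) (h2 : k + 1 < p + n) : sym f p n * f k = (s : Scalar) • sym f p n := by
  apply op_injective
  rw [op_mul, op_smul, ← hf.symRev_eq_sym h, ← sym_op]
  exact hf.op.mul_sym h h1 h2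

theorem IsHecke.sym_mul_sym {f : ℕ → R} {N : ℕ} (hf : IsHecke f N) {p n : ℕ}
    (h : p + n ≤ N + 1) : sym f p n * sym f p n = symScalar n • sym f p n := by
  rw [mul_sym_of_eigen fun k h1 h2 => hf.sym_mul h h1 h2, sym_const]

end Symmetrizer

/-! ### Sums over permutations -/

/-- The permutation with the first value `p` whose other values are ordered like those of `e`. -/
def consPerm {n : ℕ} : Fin (n + 1) × Equiv.Perm (Fin n) → Equiv.Perm (Fin (n + 1)) := fun x =>
  (finSuccEquiv n).trans ((Equiv.optionCongr x.2).trans (finSuccEquiv' x.1).symm)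

theorem consPerm_zero {n : ℕ} (x : Fin (n + 1) × Equiv.Perm (Fin n)) : consPerm x 0 = x.1 := by
  simp [consPerm]

theorem consPerm_succ {n : ℕ} (x : Fin (n + 1) × Equiv.Perm (Fin n)) (i : Fin n) :
    consPerm x i.succ = x.1.succAbove (x.2 i) := by
  simp [consPerm]

theorem consPerm_bijective {n : ℕ} : Function.Bijective (consPerm (n := n)) := by
  rw [Fintype.bijective_iff_injective_and_card]
  constructor
  · rintro ⟨p, e⟩ ⟨q, e'⟩ h
    have h0 : p = q := by simpa [consPerm_zero] using congrArg (fun π => π 0) h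
    subst h0
    congr 1
    ext1 i
    have := congrArg (fun π => π i.succ) h
    simpa [consPerm_succ] using this
  · simp [Fintype.card_perm, Nat.factorial_succ]

/-- The positions that form an inversion with position `0` are those holding one of the values below
the first value, whatever their order. -/
theorem code_consPerm_zero {n : ℕ} (x : Fin (n + 1) × Equiv.Perm (Fin n)) :
    code (consPerm x) 0 = x.1 := by
  have e : ∀ j : Fin n, (x.1.succAbove j < x.1) ↔ ((j : ℕ) < x.1) := fun j => by
    rw [Fin.succAbove_lt_iff_castSucc_lt, Fin.lt_def, Fin.val_castSucc]
  simp only [code, Finset.card_filter, Fin.sum_univ_succ, consPerm_zero, consPerm_succ,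
    lt_self_iff_false, false_and, if_false, zero_add, Fin.succ_pos, true_and]
  rw [Equiv.sum_comp x.2 fun j => if x.1.succAbove j < x.1 then 1 else 0]
  simp only [e]
  rw [← Finset.card_filter, Fin.card_filter_val_lt]
  omega

theorem code_consPerm_succ {n : ℕ} (x : Fin (n + 1) × Equiv.Perm (Fin n)) (i : Fin n) :
    code (consPerm x) i.succ = code x.2 i := by
  simp [code, Finset.card_filter, Fin.sum_univ_succ, consPerm_zero, consPerm_succ,
    -Finset.sum_boole]

theorem permLength_eq_sum_code {n : ℕ} (π : Equiv.Perm (Fin n)) :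
    permLength π = ∑ i, code π i := by
  simp only [permLength, code, Finset.card_filter]
  rw [← Finset.univ_product_univ, Finset.sum_product]

theorem permLength_consPerm {n : ℕ} (x : Fin (n + 1) × Equiv.Perm (Fin n)) :
    permLength (consPerm x) = x.1 + permLength x.2 := by
  simp [permLength_eq_sum_code, Fin.sum_univ_succ, code_consPerm_zero, code_consPerm_succ]

theorem permWord_consPerm {n : ℕ} (x : Fin (n + 1) × Equiv.Perm (Fin n)) :
    permWord (consPerm x) = (List.range x.1).reverse ++ (permWord x.2).map (· + 1) := by
  simp only [permWord, List.finRange_succ, List.flatMap_cons, code_consPerm_zero, List.flatMap_map,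
    code_consPerm_succ, List.map_flatMap, List.map_map]
  congr 1
  · simp
  · congr 1; funext i; congr 1; funext k; simp; omega

theorem prod_reverse_range {M : Type*} [Monoid M] (f : ℕ → M) (p n : ℕ) :
    ((List.range n).reverse.map fun k => f (p + k)).prod = desc f p n := by
  induction n with
  | zero => simp
  | succ n ih => 
    rw [List.range_succ, desc_succ', List.reverse_append, List.map_append, List.prod_append, ih]
    simp

/-- Splitting off the first value `c` of a permutation splits off the factor `s ^ c • desc f p c`;
the remaining permutation acts one strand further right, as in the recursion for `sym`. -/
theorem sum_perm_eq_sym {R : Type*} [Ring R] [Algebra Scalar R] (f : ℕ → R) (p n : ℕ) :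
    ∑ π : Equiv.Perm (Fin n), (s : Scalar) ^ permLength π •
      ((permWord π).map fun k => f (p + k)).prod = sym f p n := by
  induction n generalizing p with
  | zero => simp [sym, permLength, permWord]
  | succ n ih =>
    rw [← consPerm_bijective.sum_comp, Fintype.sum_prod_type, sym, ← ih, Finset.sum_mul,
      ← Fin.sum_univ_eq_sum_range fun c => (s : Scalar) ^ c • desc f p c *
        ∑ π : Equiv.Perm (Fin n), (s : Scalar) ^ permLength π •
          ((permWord π).map fun k => f (p + 1 + k)).prod]
    refine Finset.sum_congr rfl fun c _ => ?_
    rw [Finset.mul_sum]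
    refine Finset.sum_congr rfl fun e _ => ?_
    rw [permLength_consPerm, permWord_consPerm, List.map_append, List.prod_append,
      prod_reverse_range, smul_mul_smul_comm, pow_add, List.map_map]
    simp only [Function.comp_def, add_assoc, add_comm 1]

end

section PowerSeries

/-! ### Newton's relation for power series -/

open PowerSeries hiding X

variable {S : Type*} [CommRing S]

/-- The derivation `t d/dt`. -/
noncomputable def eulerDeriv (S : Type*) [CommRing S] : Derivation S S⟦X⟧ S⟦X⟧ :=
  (PowerSeries.X : S⟦X⟧) • derivative S

theorem coeff_eulerDeriv (f : S⟦X⟧) (n : ℕ) : coeff n (eulerDeriv S f) = n * coeff n f := by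
  rw [eulerDeriv, Derivation.smul_apply, smul_eq_mul]
  cases n with
  | zero => simp
  | succ n => rw [coeff_succ_X_mul, coeff_derivative]; push_cast; ring

theorem eulerDeriv_rescale (q : S) (f : S⟦X⟧) :
    eulerDeriv S (rescale q f) = rescale q (eulerDeriv S f) := by
  ext n
  simp only [coeff_eulerDeriv, coeff_rescale]
  ring

/-- The logarithmic derivative of `H(qt) = A(t) H(q't)`, written without logarithms: `P` is the
logarithmic derivative of `H` and `B` is the inverse of `A`. The constant term of `H` makes `H(q't)`
cancellable. -/
theorem rescale_sub_rescale_of_newton {q q' : S} {A B H P Y : S⟦X⟧} (hH : constantCoeff H = 1)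
    (hBA : B * A = 1) (hY : Y = B * eulerDeriv S A) (hHA : rescale q H = A * rescale q' H)
    (hP : eulerDeriv S H = P * H) : rescale q P - rescale q' P = Y := by
  have hu : IsUnit (rescale q' H) := by
    rw [isUnit_iff_constantCoeff, ← coeff_zero_eq_constantCoeff_apply, coeff_rescale]
    simp [hH]
  have e := congrArg (eulerDeriv S) hHA
  rw [Derivation.leibniz, eulerDeriv_rescale, eulerDeriv_rescale, hP, map_mul, map_mul, hHA,
    smul_eq_mul, smul_eq_mul] at e
  apply hu.mul_right_cancel
  rw [hY]
  linear_combination B * e - (rescale q P - rescale q' P) * rescale q' H * hBA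

theorem pow_sub_pow_mul_of_newton {q q' : S} {a b h p y : ℕ → S} (hh : h 0 = 1)
    (hba : ∀ n, ∑ x ∈ Finset.HasAntidiagonal.antidiagonal n, b x.1 * a x.2 = if n = 0 then 1 else 0)
    (hy : ∀ n, y n = ∑ x ∈ Finset.HasAntidiagonal.antidiagonal n, b x.1 * (x.2 * a x.2))
    (hha : ∀ n, q ^ n * h n = ∑ x ∈ Finset.HasAntidiagonal.antidiagonal n, a x.1 * (q' ^ x.2 * h x.2))
    (hp : ∀ n, n * h n = ∑ x ∈ Finset.HasAntidiagonal.antidiagonal n, p x.1 * h x.2) (n : ℕ) :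
    (q ^ n - q' ^ n) * p n = y n := by
  have := congrArg (coeff n) (rescale_sub_rescale_of_newton (q := q) (q' := q') (A := mk a)
    (B := mk b) (H := mk h) (P := mk p) (Y := mk y)
    (by rw [← coeff_zero_eq_constantCoeff_apply, coeff_mk, hh])
    (by ext n; rw [coeff_mul, coeff_one]; simpa using hba n)
    (by ext n; rw [coeff_mul]; simpa [coeff_eulerDeriv] using hy n)
    (by ext n; rw [coeff_mul]; simpa [coeff_rescale] using hha n)
    (by ext n; rw [coeff_mul]; simpa [coeff_eulerDeriv] using hp n))
  rw [map_sub, coeff_rescale, coeff_rescale, coeff_mk, coeff_mk, ← sub_mul] at this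
  exact this

end PowerSeries

noncomputable section

/-! ### Classes of words in the skeins -/

-- Scalars are central because `quotMul` is bilinear.
local instance (a : Obj) : Algebra Scalar (RectSkein a) :=
  Algebra.ofModule
    (fun c x y => LinearMap.congr_fun ((quotMul (rectRel_isIdeal a)).map_smul c x) y)
    (fun c x y => (quotMul (rectRel_isIdeal a) x).map_smul c y)

local instance : Algebra Scalar Annulus :=
  Algebra.ofModule
    (fun c x y => LinearMap.congr_fun ((quotMul annulusRel_isIdeal).map_smul c x) y)
    (fun c x y => (quotMul annulusRel_isIdeal x).map_smul c y)

theorem RectSkein.induction {a : Obj} {p : RectSkein a → Prop} (x : RectSkein a)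
    (tangle : ∀ t : Tangle a a, p t.toSkein) (zero : p 0) (add : ∀ x y, p x → p y → p (x + y))
    (smul : ∀ (c : Scalar) x, p x → p (c • x)) : p x :=
  quot_induction (N := rectRel a a) x tangle zero add smul

theorem Tangle.toSkein_mul {a : Obj} (t u : Tangle a a) :
    t.toSkein * u.toSkein = (t.comp u).toSkein := by
  change quotMul (rectRel_isIdeal a) ((rectRel a a).mkQ _) ((rectRel a a).mkQ _) =
    (rectRel a a).mkQ _
  rw [quotMul_mk, freeMul_single_left, one_smul, Finsupp.mapDomain_single]
  rfl

theorem Diagram.toSkein_mul (d e : Diagram) : d.toSkein * e.toSkein = (d * e).toSkein := by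
  change quotMul annulusRel_isIdeal (annulusRel.mkQ _) (annulusRel.mkQ _) = annulusRel.mkQ _
  rw [quotMul_mk, freeMul_single_left, one_smul, Finsupp.mapDomain_single]

theorem closure_toSkein {a : Obj} (t : Tangle a a) : closure a t.toSkein = t.close.toSkein :=
  congrArg annulusRel.mkQ Finsupp.mapDomain_single

theorem meridianMap_toSkein (ε : Bool) (d : Diagram) :
    meridianMap ε d.toSkein = (d.meridian ε).toSkein :=
  congrArg annulusRel.mkQ Finsupp.mapDomain_single

theorem ClosedIso.toSkein {d e : Diagram} (h : ClosedIso d e) : d.toSkein = e.toSkein :=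
  (Submodule.Quotient.eq annulusRel).2 h

open Classical in
/-- The class of the diagram `w` in the rectangle (and `0` if `w` is not a tangle diagram with
the boundary `a`). -/
def cls (a : Obj) (w : Word) : RectSkein a :=
  if h : IsTangle a w a then Tangle.toSkein ⟨w, h⟩ else 0

theorem cls_of {a : Obj} {w : Word} (h : IsTangle a w a) : cls a w = Tangle.toSkein ⟨w, h⟩ :=
  dif_pos h

theorem Tangle.toSkein_eq_cls {a : Obj} (t : Tangle a a) : t.toSkein = cls a t.word :=
  (cls_of t.isTangle).symm

theorem cls_nil (a : Obj) : cls a [] = 1 := cls_of (a := a) (w := []) rfl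

theorem cls_mul {a : Obj} {w u : Word} (hw : IsTangle a w a) (hu : IsTangle a u a) :
    cls a w * cls a u = cls a (w ++ u) := by
  rw [cls_of hw, cls_of hu, cls_of (hw.append hu), Tangle.toSkein_mul]
  rfl

theorem Iso.cls {a : Obj} {w u : Word} (h : Iso a a w u) : cls a w = cls a u := by
  rw [cls_of h.left, cls_of h.right]
  obtain ⟨hw, hu, h⟩ := h
  exact (Submodule.Quotient.eq (rectRel a a)).2 h

theorem closure_cls {a : Obj} {w : Word} (h : IsTangle a w a) :
    closure a (cls a w) = Diagram.toSkein ⟨a, w, h⟩ := by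
  rw [cls_of h, closure_toSkein]
  rfl

/-- Closure is a trace: the annulus may be cut between `x` and `y` or between `y` and `x`. -/
theorem closure_mul_comm {a : Obj} (x y : RectSkein a) : closure a (x * y) = closure a (y * x) := by
  induction x using RectSkein.induction with
  | zero => simp
  | add x x' hx hx' => simp only [add_mul, mul_add, map_add, hx, hx']
  | smul c x hx => simp only [smul_mul_assoc, mul_smul_comm, map_smul, hx]
  | tangle t =>
  induction y using RectSkein.induction with
  | zero => simp
  | add x x' hx hx' => simp only [add_mul, mul_add, map_add, hx, hx']
  | smul c x hx => simp only [smul_mul_assoc, mul_smul_comm, map_smul, hx]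
  | tangle u =>
  rw [Tangle.toSkein_mul, Tangle.toSkein_mul, closure_toSkein, closure_toSkein]
  exact (closedIso_rotate t.isTangle u.isTangle).toSkein

theorem closure_mul_closure {a b : Obj} {w u : Word} (hw : IsTangle a w a) (hu : IsTangle b u b) :
    closure a (cls a w) * closure b (cls b u) =
      closure (a ++ b) (cls (a ++ b) (w ++ shift a.length u)) := by
  rw [closure_cls hw, closure_cls hu, closure_cls ((hw.padRight b).append (hu.padLeft a)),
    Diagram.toSkein_mul]
  rfl

/-- Cut open along the same radius, the meridian becomes a circle around all strands below `x`, so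
questions about `φ` become computations in `H_m`. -/
theorem meridianMap_closure (ε : Bool) {a : Obj} (x : RectSkein a) :
    meridianMap ε (closure a x) = closure a (cls a (meridianWord ε a.length) * x) := by
  induction x using RectSkein.induction with
  | zero => simp
  | add x x' hx hx' => simp only [mul_add, map_add, hx, hx']
  | smul c x hx => simp only [mul_smul_comm, map_smul, hx]
  | tangle t =>
  rw [cls_of (isTangle_meridianWord ε a), Tangle.toSkein_mul, closure_toSkein, closure_toSkein,
    meridianMap_toSkein]
  rfl

/-! ### Local relations -/

/-- Turns each defining relation into an equation between classes of words in an arbitrary context.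
-/
theorem linearCombination_cls_eq_zero {a x y P Q : Obj} {w₁ w₂ : Word} {r : Tangle x y →₀ Scalar}
    (hr : LocalRel x y r) (h₁ : IsTangle a w₁ (P ++ x ++ Q)) (h₂ : IsTangle (P ++ y ++ Q) w₂ a) :
    Finsupp.linearCombination Scalar
      (fun t : Tangle x y => cls a (w₁ ++ shift P.length t.word ++ w₂)) r = 0 := by
  let F : Tangle x y → Tangle a a := fun t =>
    ((⟨w₁, h₁⟩ : Tangle a (P ++ x ++ Q)).comp (t.pad P Q)).comp ⟨w₂, h₂⟩
  have h : (rectRel a a).mkQ (r.mapDomain F) = 0 :=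
    (Submodule.Quotient.mk_eq_zero _).2
      (Submodule.subset_span ⟨x, y, P, Q, ⟨w₁, h₁⟩, ⟨w₂, h₂⟩, r, hr, rfl⟩)
  have e : Finsupp.linearCombination Scalar
      (fun t : Tangle x y => cls a (w₁ ++ shift P.length t.word ++ w₂)) =
      (rectRel a a).mkQ ∘ₗ Finsupp.lmapDomain Scalar Scalar F := by
    refine Finsupp.lhom_ext' fun t => LinearMap.ext_ring ?_
    simp only [LinearMap.comp_apply, Finsupp.lsingle_apply, Finsupp.linearCombination_single,
      one_smul]
    exact (cls_of (F t).isTangle).trans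
      (congrArg (rectRel a a).mkQ (Finsupp.mapDomain_single (f := F)).symm)
  rw [e]
  exact h

section Context

variable {a P Q : Obj} {w₁ w₂ : Word} {k : ℕ}

theorem cls_crossing (ε : Bool) (hk : P.length = k) (h₁ : IsTangle a w₁ (P ++ [ε, ε] ++ Q))
    (h₂ : IsTangle (P ++ [ε, ε] ++ Q) w₂ a) :
    cls a (w₁ ++ [(k, .cross true)] ++ w₂) =
      cls a (w₁ ++ [(k, .cross false)] ++ w₂) + (z : Scalar) • cls a (w₁ ++ w₂) := by
  have := linearCombination_cls_eq_zero (.crossing ε ⟨_, isTangle_cross true ε ε⟩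
    ⟨_, isTangle_cross false ε ε⟩ rfl rfl) h₁ h₂
  rw [map_sub, map_sub, sub_eq_zero, sub_eq_iff_eq_add'] at this
  simpa [Tangle.id, hk] using this

theorem isTangle_curl_left (o ε : Bool) :
    IsTangle [ε] [(0, .cup (!ε)), (1, .cross o), (0, .cap)] [ε] := by
  have h1 := (isTangle_gen (g := .cup (!ε)) ⟨rfl, rfl⟩).padRight [ε]
  have h2 := (isTangle_cross o (!!ε) ε).padLeft [!ε]
  have h3 := (isTangle_gen (g := .cap) (x := [!ε, ε]) ⟨⟨!ε, by simp⟩, rfl⟩).padRight [ε]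
  simpa using (h1.append h2).append (by simpa using h3)

theorem isTangle_curl_right (o ε : Bool) :
    IsTangle [ε] [(1, .cup ε), (0, .cross o), (1, .cap)] [ε] := by
  have h1 := (isTangle_gen (g := .cup ε) ⟨rfl, rfl⟩).padLeft [ε]
  have h2 := (isTangle_cross o ε ε).padRight [!ε]
  have h3 := (isTangle_gen (g := .cap) (x := [ε, !ε]) ⟨⟨ε, rfl⟩, rfl⟩).padLeft [ε]
  simpa using (h1.append h2).append (by simpa using h3)

theorem cls_curl_left_pos (ε : Bool) (hk : P.length = k) (h₁ : IsTangle a w₁ (P ++ [ε] ++ Q))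
    (h₂ : IsTangle (P ++ [ε] ++ Q) w₂ a) :
    cls a (w₁ ++ [(k, .cup (!ε)), (k + 1, .cross true), (k, .cap)] ++ w₂) =
      ((v⁻¹ : Scalarˣ) : Scalar) • cls a (w₁ ++ w₂) := by
  have := linearCombination_cls_eq_zero (.curl_left_pos ε ⟨_, isTangle_curl_left true ε⟩ rfl) h₁ h₂
  rw [map_sub, sub_eq_zero] at this
  simpa [Tangle.id, hk] using this

theorem cls_curl_right_neg (ε : Bool) (hk : P.length = k) (h₁ : IsTangle a w₁ (P ++ [ε] ++ Q))
    (h₂ : IsTangle (P ++ [ε] ++ Q) w₂ a) :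
    cls a (w₁ ++ [(k + 1, .cup ε), (k, .cross false), (k + 1, .cap)] ++ w₂) =
      (v : Scalar) • cls a (w₁ ++ w₂) := by
  have := linearCombination_cls_eq_zero (.curl_right_neg ε ⟨_, isTangle_curl_right false ε⟩ rfl)
    h₁ h₂
  rw [map_sub, sub_eq_zero] at this
  simpa [Tangle.id, hk] using this

theorem cls_circle (ε : Bool) (hk : P.length = k) (h₁ : IsTangle a w₁ (P ++ Q))
    (h₂ : IsTangle (P ++ Q) w₂ a) :
    cls a (w₁ ++ [(k, .cup ε), (k, .cap)] ++ w₂) = δ • cls a (w₁ ++ w₂) := by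
  have h : IsTangle [] [(0, .cup ε), (0, .cap)] [] :=
    (isTangle_gen (g := .cup ε) ⟨rfl, rfl⟩).append
      (isTangle_gen (g := .cap) ⟨⟨ε, rfl⟩, rfl⟩)
  have := linearCombination_cls_eq_zero (P := P) (Q := Q) (.circle ε ⟨_, h⟩ rfl)
    (by simpa using h₁) (by simpa using h₂)
  rw [map_sub, sub_eq_zero] at this
  simpa [Tangle.id, hk] using this

end Context

/-! ### The elementary braids -/

theorem sigma_of {m k : ℕ} (o : Bool) (h : k + 1 < m) : sigma m o k = cls (up m) [(k, .cross o)] := by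
  rw [sigma, dif_pos h, Tangle.toSkein_eq_cls]

theorem sigma_mul_sigma_not (m : ℕ) (o : Bool) (k : ℕ) : sigma m o k * sigma m (!o) k = 1 := by
  by_cases h : k + 1 < m
  · obtain ⟨n, rfl⟩ : ∃ n, m = k + 2 + n := ⟨m - (k + 2), by omega⟩
    have e : up (k + 2 + n) = up k ++ [true, true] ++ up n := by
      simp only [up, List.replicate_add]; rfl
    rw [sigma_of o h, sigma_of (!o) h, cls_mul (isTangle_sigma o h) (isTangle_sigma _ h), ← cls_nil]
    have := (iso_two o true true).pad (up k) (up n)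
    rw [← e] at this
    simpa using this.cls
  · rw [sigma, sigma, dif_neg h, dif_neg h, one_mul]

theorem sigma_commute {m k l : ℕ} (o o' : Bool) (hkl : k + 2 ≤ l) :
    Commute (sigma m o k) (sigma m o' l) := by
  by_cases h : l + 1 < m
  · obtain ⟨d, rfl⟩ := Nat.exists_eq_add_of_le hkl
    obtain ⟨n, rfl⟩ : ∃ n, m = k + 2 + d + 2 + n := ⟨m - (k + 2 + d + 2), by omega⟩
    have e : up (k + 2 + d + 2 + n) =
        up k ++ ([true, true] ++ (up d ++ [true, true])) ++ up n := by
      simp only [up, List.replicate_add, List.append_assoc]; rfl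
    rw [Commute, SemiconjBy, sigma_of o (by omega), sigma_of o' h,
      cls_mul (isTangle_sigma o (by omega)) (isTangle_sigma _ h),
      cls_mul (isTangle_sigma o' (by omega)) (isTangle_sigma _ (by omega))]
    have := (iso_interchange (isTangle_cross o true true)
      ((isTangle_cross o' true true).padLeft (up d))).pad (up k) (up n)
    rw [← e] at this
    simpa [add_assoc] using this.cls
  · rw [sigma, sigma, dif_neg h]
    exact Commute.one_right _

theorem sigma_braid {m k : ℕ} (o : Bool) (h : k + 2 < m) :
    sigma m o k * sigma m o (k + 1) * sigma m o k =
      sigma m o (k + 1) * sigma m o k * sigma m o (k + 1) := by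
  obtain ⟨n, rfl⟩ : ∃ n, m = k + 3 + n := ⟨m - (k + 3), by omega⟩
  have e : up (k + 3 + n) = up k ++ [true, true, true] ++ up n := by
    simp only [up, List.replicate_add]; rfl
  have t1 := isTangle_sigma (m := k + 3 + n) (k := k) o (by omega)
  have t2 := isTangle_sigma (m := k + 3 + n) (k := k + 1) o (by omega)
  rw [sigma_of o (by omega), sigma_of o (by omega), cls_mul t1 t2, cls_mul t2 t1,
    cls_mul (t1.append t2) t1, cls_mul (t2.append t1) t2]
  have c1 := (isTangle_cross o true true).padRight [true]
  have c2 := (isTangle_cross o true true).padLeft [true]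
  have := (Iso.of_move (.reidemeister_three o) ((c1.append c2).append c1)
    ((c2.append c1).append c2)).pad (up k) (up n)
  have e' : ([true, true] ++ [true] : Obj) = [true, true, true] := rfl
  rw [e', ← e] at this
  simpa using this.cls

theorem sigma_sub_sigma {m k : ℕ} (h : k + 1 < m) :
    sigma m true k = sigma m false k + (z : Scalar) • 1 := by
  obtain ⟨n, rfl⟩ : ∃ n, m = k + 2 + n := ⟨m - (k + 2), by omega⟩
  have e : up (k + 2 + n) = up k ++ [true, true] ++ up n := by
    simp only [up, List.replicate_add]; rfl
  rw [sigma_of _ h, sigma_of _ h, ← cls_nil]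
  exact cls_crossing (w₁ := []) (w₂ := []) (P := up k) (Q := up n) true (by simp) e e.symm

theorem isHecke_sigma (m : ℕ) : IsHecke (sigma m true) (m - 1) where
  comm k l h _ := sigma_commute true true h
  braid k h := sigma_braid true (by omega)
  quad k h := by
    have e := sigma_mul_sigma_not m true k
    -- The quadratic relation is the skein relation `σ = σ⁻¹ + z` multiplied by `σ`.
    nth_rw 2 [sigma_sub_sigma (by omega)]
    rw [mul_add, mul_smul_comm, mul_one, add_comm]
    congr 1

/-- The elementary braids as units. -/
def gen (m k : ℕ) : (Hecke m)ˣ where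
  val := sigma m true k
  inv := sigma m false k
  val_inv := sigma_mul_sigma_not m true k
  inv_val := sigma_mul_sigma_not m false k

theorem isBraid_gen (m : ℕ) : IsBraid (gen m) (m - 1) where
  comm k l h h' := Units.ext ((isHecke_sigma m).comm k l h h').eq
  braid k h := Units.ext ((isHecke_sigma m).braid k h)

/-! ### Strands that pass to the left -/

/-- The strand at position `k + n` passes to the left across `n` strands, below them if `o` is
`true` and above them if `o` is `false`. -/
def passLeft (o : Bool) (k n : ℕ) : Word := (List.range n).reverse.map fun i => (k + i, Gen.cross o)

theorem shift_passLeft (o : Bool) (j k n : ℕ) :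
    shift j (passLeft o k n) = passLeft o (j + k) n := by
  simp [passLeft, shift, Function.comp_def, add_assoc]

theorem pass_succ (o : Bool) (k n : ℕ) : pass o k (n + 1) = (k, .cross o) :: pass o (k + 1) n := by
  rw [add_comm, pass_add]; rfl

theorem pass_succ' (o : Bool) (k n : ℕ) :
    pass o k (n + 1) = pass o k n ++ [(k + n, .cross o)] := by
  rw [pass_add]; rfl

theorem passLeft_succ (o : Bool) (k n : ℕ) :
    passLeft o k (n + 1) = passLeft o (k + 1) n ++ [(k, .cross o)] := by
  simp [passLeft, List.range_succ_eq_map, Function.comp_def, add_assoc, add_comm 1]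

theorem isTangle_passLeft (o η : Bool) (b : Obj) :
    IsTangle (b ++ [η]) (passLeft o 0 b.length) (η :: b) := by
  induction b with
  | nil => rfl
  | cons c b ih =>
    rw [List.length_cons, passLeft_succ]
    refine IsTangle.append (b := c :: η :: b) ?_ ((isTangle_cross o c η).padRight b)
    simpa [shift_passLeft] using ih.padLeft [c]

theorem isTangle_cup (ε : Bool) : IsTangle [] [(0, .cup ε)] [ε, !ε] :=
  isTangle_gen (g := .cup ε) ⟨rfl, rfl⟩

theorem isTangle_cap (ε : Bool) : IsTangle [ε, !ε] [(0, .cap)] [] :=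
  isTangle_gen (g := .cap) ⟨⟨ε, rfl⟩, rfl⟩

theorem iso_slide_cap (o ε η : Bool) :
    Iso [ε, η, !ε] [η] [(0, .cross o), (1, .cap)] [(1, .cross (!o)), (0, .cap)] :=
  Iso.of_move (.slide_cap o)
    (((isTangle_cross o ε η).padRight [!ε]).append ((isTangle_cap ε).padLeft [η]))
    (((isTangle_cross (!o) η (!ε)).padLeft [ε]).append ((isTangle_cap ε).padRight [η]))

theorem iso_slide_cup (o ε η : Bool) :
    Iso [η] [ε, η, !ε] [(1, .cup ε), (0, .cross o)] [(0, .cup ε), (1, .cross (!o))] :=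
  Iso.of_move (.slide_cup ε o)
    (((isTangle_cup ε).padLeft [η]).append ((isTangle_cross o η ε).padRight [!ε]))
    (((isTangle_cup ε).padRight [η]).append ((isTangle_cross (!o) (!ε) η).padLeft [ε]))

/-- A maximum at the right of some strands moves to their left. -/
theorem iso_pass_cap (o ε : Bool) (b : Obj) :
    Iso ([ε] ++ b ++ [!ε]) b (pass o 0 b.length ++ [(b.length, .cap)])
      (passLeft (!o) 1 b.length ++ [(0, .cap)]) := by
  induction b with
  | nil => exact Iso.refl (isTangle_cap ε)
  | cons c b ih =>
    have x1 := (isTangle_cross o ε c).padRight (b ++ [!ε])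
    -- The maximum first moves past `b`; the crossing with `c` then commutes with the new crossings,
    -- and the maximum finally slides over `c`.
    have e1 := (ih.padLeft [c]).append_left (by simpa using x1)
    have e2 := (iso_interchange (isTangle_cross o ε c) (isTangle_passLeft (!o) (!ε) b)).append_right
      (((isTangle_cap ε).padLeft [c]).padRight b)
    have e3 := ((iso_slide_cap o ε c).padRight b).append_left
      ((isTangle_passLeft (!o) (!ε) b).padLeft [ε, c])
    have f1 : Iso ([ε] ++ (c :: b) ++ [!ε]) (c :: b)
        (pass o 0 (b.length + 1) ++ [(b.length + 1, .cap)])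
        ([(0, .cross o)] ++ passLeft (!o) 2 b.length ++ [(1, .cap)]) := by
      simpa [pass_succ, shift_pass, shift_passLeft, add_comm] using e1
    have f2 : Iso ([ε] ++ (c :: b) ++ [!ε]) (c :: b)
        ([(0, .cross o)] ++ passLeft (!o) 2 b.length ++ [(1, .cap)])
        (passLeft (!o) 2 b.length ++ [(0, .cross o), (1, .cap)]) := by
      simpa [shift_passLeft] using e2
    have f3 : Iso ([ε] ++ (c :: b) ++ [!ε]) (c :: b)
        (passLeft (!o) 2 b.length ++ [(0, .cross o), (1, .cap)])
        (passLeft (!o) 1 (b.length + 1) ++ [(0, .cap)]) := by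
      simpa [shift_passLeft, passLeft_succ] using e3
    exact f1.trans (f2.trans f3)

/-- A minimum at the left of some strands moves to their right. -/
theorem iso_cup_pass (o ε : Bool) (b : Obj) :
    Iso b ([ε] ++ b ++ [!ε]) ((0, .cup ε) :: pass o 1 b.length)
      ((b.length, .cup ε) :: passLeft (!o) 0 b.length) := by
  induction b with
  | nil => exact Iso.refl (isTangle_cup ε)
  | cons c b ih =>
    have e0 := iso_slide_cup (!o) ε c
    rw [Bool.not_not] at e0
    have e1 := (e0.symm.padRight b).append_right
      (by simpa using (isTangle_pass o (!ε) b).padLeft [ε, c])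
    have e2 := (iso_interchange (isTangle_cross (!o) c ε) (isTangle_pass o (!ε) b)).append_left
      (((isTangle_cup ε).padLeft [c]).padRight b)
    have e3 := (ih.padLeft [c]).append_right
      (by simpa using (isTangle_cross (!o) c ε).padRight (b ++ [!ε]))
    have f1 : Iso (c :: b) ([ε] ++ (c :: b) ++ [!ε]) ((0, .cup ε) :: pass o 1 (b.length + 1))
        ([(1, .cup ε)] ++ [(0, .cross (!o))] ++ pass o 2 b.length) := by
      simpa [pass_succ, shift_pass] using e1
    have f2 : Iso (c :: b) ([ε] ++ (c :: b) ++ [!ε])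
        ([(1, .cup ε)] ++ [(0, .cross (!o))] ++ pass o 2 b.length)
        ([(1, .cup ε)] ++ pass o 2 b.length ++ [(0, .cross (!o))]) := by
      simpa [shift_pass] using e2
    have f3 : Iso (c :: b) ([ε] ++ (c :: b) ++ [!ε])
        ([(1, .cup ε)] ++ pass o 2 b.length ++ [(0, .cross (!o))])
        ((b.length + 1, .cup ε) :: passLeft (!o) 0 (b.length + 1)) := by
      simpa [shift_pass, shift_passLeft, passLeft_succ, add_comm] using e3
    exact f1.trans (f2.trans f3)

/-! ### Removing a strand from a meridian -/

/-- The meridian without its minimum. -/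
def meridianTail (n : ℕ) : Word := pass true 1 n ++ pass false 0 n ++ [(n, .cap)]

theorem meridianWord_eq (ε : Bool) (n : ℕ) :
    meridianWord ε n = (0, .cup ε) :: meridianTail n := by
  simp [meridianWord, meridianTail]

theorem isTangle_meridianTail (ε : Bool) (b : Obj) :
    IsTangle ([ε, !ε] ++ b) (meridianTail b.length) b := by
  have h2 := (isTangle_pass true (!ε) b).padLeft [ε]
  have h3 := (isTangle_pass false ε b).padRight [!ε]
  have h4 := (isTangle_cap ε).padLeft b
  have := (h2.append (by simpa using h3)).append (by simpa using h4)
  simpa [meridianTail, shift_pass] using this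

/-- The lower crossing with the leftmost strand is brought down next to the upper one, so that the
meridian's encounter with this strand stands apart from the rest. -/
theorem iso_meridian_cons (b : Obj) :
    Iso (true :: b) (true :: b) (meridianWord false (b.length + 1))
      ([(0, .cup false), (1, .cross true), (0, .cross false)] ++
        shift 1 (meridianTail b.length)) := by
  have c := (isTangle_cup false).padRight (true :: b)
  have x := ((isTangle_cross true true true).padLeft [false]).padRight b
  have t1 := ((isTangle_pass false false b).padRight [true]).padLeft [true]
  have t2 := ((isTangle_cap false).padLeft b).padLeft [true]
  have e := ((iso_interchange (isTangle_cross false false true)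
    (isTangle_pass true true b)).symm.append_left (c.append x)).append_right
      (by simpa using t1.append (by simpa using t2))
  simpa [meridianWord, meridianTail, pass_succ, shift_pass, add_comm] using e

/-- With the first crossing switched, the strand lies above the meridian at both crossings and the
meridian is pulled off it. -/
theorem iso_meridian_cons_false (b : Obj) :
    Iso (true :: b) (true :: b)
      ([(0, .cup false), (1, .cross false), (0, .cross false)] ++ shift 1 (meridianTail b.length))
      (shift 1 (meridianWord false b.length)) := by
  have e1 := (iso_slide_cup true false true).symm.append_right
    ((isTangle_cross false false true).padRight [true])
  have e2 := ((iso_two true true false).padRight [true]).append_left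
    ((isTangle_cup false).padLeft [true])
  have e3 : Iso [true] [true, false, true]
      [(0, .cup false), (1, .cross false), (0, .cross false)] [(1, .cup false)] :=
    Iso.trans (by simpa using e1) (by simpa using e2)
  have := (e3.padRight b).append_right ((isTangle_meridianTail false b).padLeft [true])
  simpa [meridianWord_eq] using this

theorem isTangle_pass_passLeft (b : Obj) :
    IsTangle (true :: b) (pass true 0 b.length ++ passLeft true 0 b.length) (true :: b) :=
  (isTangle_pass true true b).append (isTangle_passLeft true true b)

/-- After smoothing, the strand continues along the meridian around all of `b`. Moving the maximum
back to the left straightens this into a braid and leaves a positive curl. -/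
theorem iso_meridian_cons_smooth (b : Obj) :
    Iso (true :: b) (true :: b)
      ([(0, .cup false), (0, .cross false)] ++ shift 1 (meridianTail b.length))
      (pass true 0 b.length ++ passLeft true 0 b.length ++
        [(0, .cup false), (1, .cross true), (0, .cap)]) := by
  have x : IsTangle [] [(0, .cup false), (0, .cross false)] [true, false] :=
    (isTangle_cup false).append (isTangle_cross false false true)
  have p := (isTangle_pass true true b).padLeft [true, false]
  have c := (isTangle_cap false).padLeft [true]
  have e1 := ((iso_pass_cap false false b).padLeft [true]).append_left
    ((x.padRight (true :: b)).append (by simpa using p))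
  have e2 := (iso_interchange x (isTangle_pass_passLeft b)).append_right
    (by simpa using c.padRight b)
  have e3 := ((iso_slide_cap false false true).padRight b).append_left
    ((isTangle_pass_passLeft b).append ((isTangle_cup false).padRight (true :: b)))
  have f1 : Iso (true :: b) (true :: b)
      ([(0, .cup false), (0, .cross false)] ++ shift 1 (meridianTail b.length))
      ([(0, .cup false), (0, .cross false)] ++ pass true 2 b.length ++ passLeft true 2 b.length ++
        [(1, .cap)]) := by
    simpa [meridianTail, shift_pass, shift_passLeft] using e1
  have f2 : Iso (true :: b) (true :: b)
      ([(0, .cup false), (0, .cross false)] ++ pass true 2 b.length ++ passLeft true 2 b.length ++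
        [(1, .cap)])
      (pass true 0 b.length ++ passLeft true 0 b.length ++
        [(0, .cup false), (0, .cross false), (1, .cap)]) := by
    simpa [shift_pass, shift_passLeft] using e2
  have f3 : Iso (true :: b) (true :: b)
      (pass true 0 b.length ++ passLeft true 0 b.length ++
        [(0, .cup false), (0, .cross false), (1, .cap)])
      (pass true 0 b.length ++ passLeft true 0 b.length ++
        [(0, .cup false), (1, .cross true), (0, .cap)]) := by
    simpa using e3
  exact f1.trans (f2.trans f3)

theorem cls_meridian_cons {a P b : Obj} (ha : a = P ++ true :: b) :
    cls a (shift P.length (meridianWord false (b.length + 1))) =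
      cls a (shift (P.length + 1) (meridianWord false b.length)) +
        ((z : Scalar) * ((v⁻¹ : Scalarˣ) : Scalar)) •
          cls a (shift P.length (pass true 0 b.length ++ passLeft true 0 b.length)) := by
  subst ha
  have e1 := ((iso_meridian_cons b).padLeft P).cls
  have e2 := ((iso_meridian_cons_false b).padLeft P).cls
  have e3 := ((iso_meridian_cons_smooth b).padLeft P).cls
  have c := ((isTangle_cup false).padRight (true :: b)).padLeft P
  have x := (((isTangle_cross false false true).padRight (true :: b)).append
    (by simpa using (isTangle_meridianTail false b).padLeft [true])).padLeft P
  -- The upper part of this meridian is parallel to the strand after the minimum, whose left end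
  -- contributes the extra `false` on the left of the crossing.
  have l1 := cls_crossing (P := P ++ [false]) (Q := b) (k := P.length + 1) true (by simp)
    (by simpa using c) (by simpa using x)
  have l2 := cls_curl_left_pos (P := P) (Q := b) (k := P.length) (w₂ := []) true rfl
    (by simpa using (isTangle_pass_passLeft b).padLeft P) (by simp [IsTangle])
  simp only [shift_append, shift_cons, shift_nil, List.cons_append, List.nil_append, shift_shift,
    List.append_assoc, List.append_nil, Bool.not_true, add_zero] at e1 e2 e3 l1 l2 ⊢
  rw [e1, l1, e2, e3, l2, smul_smul]

/-- The meridian without its maximum. -/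
def meridianHead (n : ℕ) : Word := (0, .cup true) :: pass true 1 n ++ pass false 0 n

theorem isTangle_meridianHead (b : Obj) :
    IsTangle b (meridianHead b.length) (b ++ [true, false]) := by
  have h1 := (isTangle_cup true).padRight b
  have h2 := (isTangle_pass true false b).padLeft [true]
  have h3 := (isTangle_pass false true b).padRight [false]
  have := (h1.append (by simpa using h2)).append (by simpa using h3)
  simpa [meridianHead, shift_pass] using this

theorem iso_meridian_concat (b : Obj) :
    Iso (b ++ [true]) (b ++ [true]) (meridianWord true (b.length + 1))
      (meridianHead b.length ++
        [(b.length + 1, .cross true), (b.length, .cross false), (b.length + 1, .cap)]) := by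
  have c := (isTangle_cup true).padRight (b ++ [true])
  have p := ((isTangle_pass true false b).padLeft [true]).padRight [true]
  have x := ((isTangle_cross false true true).padRight [false]).padLeft b
  have t := ((isTangle_cap true).padLeft [true]).padLeft b
  have e := ((iso_interchange (isTangle_pass false true b)
    (isTangle_cross true false true)).symm.append_left
      (by simpa using c.append (by simpa using p))).append_right
        (by simpa using x.append (by simpa using t))
  simpa [meridianWord, meridianHead, pass_succ', shift_pass, add_comm] using e

/-- With the lower crossing switched, the meridian lies above the rightmost strand at both crossings
and is pulled off it. -/
theorem iso_meridian_concat_true (b : Obj) :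
    Iso (b ++ [true]) (b ++ [true])
      (meridianHead b.length ++
        [(b.length + 1, .cross true), (b.length, .cross true), (b.length + 1, .cap)])
      (meridianWord true b.length) := by
  have e1 := (iso_slide_cap true true true).append_left
    ((isTangle_cross true false true).padLeft [true])
  have e2 := ((iso_two true false true).padLeft [true]).append_right
    ((isTangle_cap true).padRight [true])
  have e3 : Iso [true, false, true] [true]
      [(1, .cross true), (0, .cross true), (1, .cap)] [(0, .cap)] :=
    Iso.trans (by simpa using e1) (by simpa using e2)
  have := (e3.padLeft b).append_left (by simpa using (isTangle_meridianHead b).padRight [true])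
  simpa [meridianWord, meridianHead] using this

theorem isTangle_passLeft_pass (b : Obj) :
    IsTangle (b ++ [true]) (passLeft false 0 b.length ++ pass false 0 b.length) (b ++ [true]) :=
  (isTangle_passLeft false true b).append (isTangle_pass false true b)

theorem iso_meridian_concat_smooth (b : Obj) :
    Iso (b ++ [true]) (b ++ [true])
      (meridianHead b.length ++ [(b.length + 1, .cross true), (b.length + 1, .cap)])
      ([(b.length + 1, .cup true), (b.length, .cross false), (b.length + 1, .cap)] ++
        (passLeft false 0 b.length ++ pass false 0 b.length)) := by
  have x : IsTangle [false, true] [(0, .cross true), (0, .cap)] [] :=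
    (isTangle_cross true false true).append (isTangle_cap true)
  have p := (isTangle_pass false true b).padRight [false, true]
  have e1 := ((iso_cup_pass true true b).padRight [true]).append_right
    (by simpa using p.append (by simpa using x.padLeft (b ++ [true])))
  have e2 := (iso_interchange (isTangle_passLeft_pass b) x).append_left
    (by simpa using ((isTangle_cup true).padLeft b).padRight [true])
  have e3 := (((iso_slide_cup false true true).symm.padLeft b).append_right
    (by simpa using ((isTangle_cap true).padLeft [true]).padLeft b)).append_right
      (isTangle_passLeft_pass b)
  have f1 : Iso (b ++ [true]) (b ++ [true])
      (meridianHead b.length ++ [(b.length + 1, .cross true), (b.length + 1, .cap)])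
      ([(b.length, .cup true)] ++ passLeft false 0 b.length ++ pass false 0 b.length ++
        [(b.length + 1, .cross true), (b.length + 1, .cap)]) := by
    simpa [meridianHead] using e1
  have f2 : Iso (b ++ [true]) (b ++ [true])
      ([(b.length, .cup true)] ++ passLeft false 0 b.length ++ pass false 0 b.length ++
        [(b.length + 1, .cross true), (b.length + 1, .cap)])
      ([(b.length, .cup true), (b.length + 1, .cross true), (b.length + 1, .cap)] ++
        (passLeft false 0 b.length ++ pass false 0 b.length)) := by
    simpa using e2
  have f3 : Iso (b ++ [true]) (b ++ [true])
      ([(b.length, .cup true), (b.length + 1, .cross true), (b.length + 1, .cap)] ++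
        (passLeft false 0 b.length ++ pass false 0 b.length))
      ([(b.length + 1, .cup true), (b.length, .cross false), (b.length + 1, .cap)] ++
        (passLeft false 0 b.length ++ pass false 0 b.length)) := by
    simpa using e3
  exact f1.trans (f2.trans f3)

theorem cls_meridian_concat {a b Q : Obj} (ha : a = b ++ true :: Q) :
    cls a (meridianWord true (b.length + 1)) =
      cls a (meridianWord true b.length) -
        ((z : Scalar) * (v : Scalar)) •
          cls a (passLeft false 0 b.length ++ pass false 0 b.length) := by
  obtain rfl : a = b ++ [true] ++ Q := by simp [ha]
  have e1 := ((iso_meridian_concat b).padRight Q).cls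
  have e2 := ((iso_meridian_concat_true b).padRight Q).cls
  have e3 := ((iso_meridian_concat_smooth b).padRight Q).cls
  have h := (isTangle_meridianHead b).padRight (true :: Q)
  have x := ((isTangle_cross true false true).padLeft (b ++ [true])).padRight Q
  have c := ((isTangle_cap true).padLeft (b ++ [true])).padRight Q
  -- For the reversed meridian it is the lower part that runs parallel to the strand. Its crossing
  -- is a `cross false`, so the smoothing enters with a minus sign, and the curl is negative.
  have l1 := cls_crossing (P := b) (Q := false :: Q) (k := b.length) true rfl
    (a := b ++ [true] ++ Q) (by simpa using h.append (by simpa using x)) (by simpa using c)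
  have l2 := cls_curl_right_neg (P := b) (Q := Q) (k := b.length) (w₁ := []) true rfl
    (a := b ++ [true] ++ Q) (by simp [IsTangle])
    (by simpa using (isTangle_passLeft_pass b).padRight Q)
  simp only [List.cons_append, List.nil_append, List.append_assoc] at e1 e2 e3 l1 l2 ⊢
  rw [e2, e3, l2, smul_smul] at l1
  rw [e1, l1, add_sub_cancel_right]

theorem RectSkein.sum_mul {a : Obj} {ι : Type*} (t : Finset ι) (f : ι → RectSkein a)
    (x : RectSkein a) : (∑ i ∈ t, f i) * x = ∑ i ∈ t, f i * x :=
  Finset.sum_mul _ _ _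

theorem RectSkein.mul_sum {a : Obj} {ι : Type*} (t : Finset ι) (f : ι → RectSkein a)
    (x : RectSkein a) : x * ∑ i ∈ t, f i = ∑ i ∈ t, x * f i :=
  Finset.mul_sum _ _ _

theorem Annulus.mul_sum {ι : Type*} (t : Finset ι) (f : ι → Annulus) (x : Annulus) :
    x * ∑ i ∈ t, f i = ∑ i ∈ t, x * f i :=
  Finset.mul_sum _ _ _

/-! ### Meridians as sums of braids -/

theorem isTangle_braid {m : ℕ} {w : Word} (h : ∀ l ∈ w, l.1 + 1 < m ∧ ∃ o, l.2 = .cross o) :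
    IsTangle (up m) w (up m) := by
  induction w with
  | nil => rfl
  | cons l w ih =>
    obtain ⟨k, g⟩ := l
    obtain ⟨h1, o, rfl⟩ := h _ List.mem_cons_self
    exact (isTangle_sigma o h1).append (ih fun l hl => h l (List.mem_cons_of_mem _ hl))

theorem cls_braid {m : ℕ} (o : Bool) {L : List ℕ} (h : ∀ k ∈ L, k + 1 < m) :
    cls (up m) (L.map fun k => (k, .cross o)) = (L.map (sigma m o)).prod := by
  induction L with
  | nil => exact cls_nil _
  | cons k L ih =>
    have h1 := h _ List.mem_cons_self
    have h2 := fun l hl => h l (List.mem_cons_of_mem _ hl)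
    rw [List.map_cons, List.map_cons, List.prod_cons, ← ih h2, sigma_of o h1,
      cls_mul (isTangle_sigma o h1) (isTangle_braid (by simpa using h2))]
    rfl

theorem prod_range {M : Type*} [Monoid M] (f : ℕ → M) (p n : ℕ) :
    ((List.range n).map fun k => f (p + k)).prod = asc f p n := by
  induction n with
  | zero => simp
  | succ n ih =>
    rw [List.range_succ, asc_succ', List.map_append, List.prod_append, ih]
    simp

theorem isTangle_pass_up {m p n : ℕ} (o : Bool) (h : p + n < m) :
    IsTangle (up m) (pass o p n) (up m) :=
  isTangle_braid (by simp [pass]; omega)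

theorem isTangle_passLeft_up {m p n : ℕ} (o : Bool) (h : p + n < m) :
    IsTangle (up m) (passLeft o p n) (up m) :=
  isTangle_braid (by simp [passLeft]; omega)

theorem cls_pass {m p n : ℕ} (o : Bool) (h : p + n < m) :
    cls (up m) (pass o p n) = asc (sigma m o) p n := by
  rw [← prod_range]
  have := cls_braid (m := m) o (L := (List.range n).map (p + ·)) (by simp; omega)
  simpa [Function.comp_def, pass] using this

theorem cls_passLeft {m p n : ℕ} (o : Bool) (h : p + n < m) :
    cls (up m) (passLeft o p n) = desc (sigma m o) p n := by
  rw [← prod_reverse_range]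
  have := cls_braid (m := m) o (L := (List.range n).reverse.map (p + ·)) (by simp; omega)
  simpa [Function.comp_def, passLeft] using this

theorem asc_gen (m p n : ℕ) : ((asc (gen m) p n : (Hecke m)ˣ) : Hecke m) = asc (sigma m true) p n :=
  map_asc (Units.coeHom _) _ _ _

theorem desc_gen (m p n : ℕ) :
    ((desc (gen m) p n : (Hecke m)ˣ) : Hecke m) = desc (sigma m true) p n :=
  map_desc (Units.coeHom _) _ _ _

theorem asc_gen_inv (m p n : ℕ) :
    (((asc (gen m) p n)⁻¹ : (Hecke m)ˣ) : Hecke m) = desc (sigma m false) p n := by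
  induction n generalizing p with
  | zero => simp
  | succ n ih => rw [asc_succ, desc_succ, mul_inv_rev, Units.val_mul, ih]; rfl

theorem desc_gen_inv (m p n : ℕ) :
    (((desc (gen m) p n)⁻¹ : (Hecke m)ˣ) : Hecke m) = asc (sigma m false) p n := by
  induction n generalizing p with
  | zero => simp
  | succ n ih => rw [asc_succ, desc_succ, mul_inv_rev, Units.val_mul, ih]; rfl

theorem cls_shift_meridian_zero {m p : ℕ} (ε : Bool) (h : p ≤ m) :
    cls (up m) (shift p (meridianWord ε 0)) = δ • 1 := by
  obtain ⟨n, rfl⟩ := Nat.exists_eq_add_of_le h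
  have e : up (p + n) = up p ++ up n := List.replicate_add _ _ _
  have := cls_circle (a := up (p + n)) (P := up p) (Q := up n) (w₁ := []) (w₂ := []) (k := p) ε
    (by simp) e e.symm
  rw [← cls_nil]
  simpa [meridianWord, pass] using this

/-- The summand `n` is the braid in which strand `m - 1 - n` runs once around the `n` strands on its
right. -/
theorem cls_meridian_false (m : ℕ) :
    cls (up m) (meridianWord false m) = δ • 1 + ((z : Scalar) * ((v⁻¹ : Scalarˣ) : Scalar)) •
      ∑ n ∈ Finset.range m, ((asc (gen m) (m - 1 - n) n * desc (gen m) (m - 1 - n) n :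
        (Hecke m)ˣ) : Hecke m) := by
  -- The induction is over the number `n` of rightmost strands that the meridian encircles; for `n =
  -- 0` it is a trivial circle.
  have h : ∀ n ≤ m, cls (up m) (shift (m - n) (meridianWord false n)) =
      δ • 1 + ((z : Scalar) * ((v⁻¹ : Scalarˣ) : Scalar)) •
        ∑ n ∈ Finset.range n, ((asc (gen m) (m - 1 - n) n * desc (gen m) (m - 1 - n) n :
          (Hecke m)ˣ) : Hecke m) := by
    intro n
    induction n with
    | zero => intro _; simp [cls_shift_meridian_zero]
    | succ n ih =>
      intro hn
      obtain ⟨p, rfl⟩ : ∃ p, m = p + (n + 1) := ⟨m - (n + 1), by omega⟩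
      have e := cls_meridian_cons (a := up (p + (n + 1))) (P := up p) (b := up n)
        (by rw [up, List.replicate_add]; rfl)
      simp only [List.length_replicate, shift_append, shift_pass, shift_passLeft, add_zero] at e
      rw [← cls_mul (isTangle_pass_up _ (by omega)) (isTangle_passLeft_up _ (by omega)),
        cls_pass _ (by omega), cls_passLeft _ (by omega), ← asc_gen, ← desc_gen,
        ← Units.val_mul (asc _ _ _)] at e
      have ih' := ih (by omega)
      rw [show p + (n + 1) - n = p + 1 by omega] at ih'
      rw [Finset.sum_range_succ, show p + (n + 1) - (n + 1) = p by omega, e, ih',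
        show p + (n + 1) - 1 - n = p by omega, smul_add, add_assoc]
  simpa using h m le_rfl

/-- Here strands are released from the right, so the braids involve the strands on the left, and
their crossings are negative. -/
theorem cls_meridian_true (m : ℕ) :
    cls (up m) (meridianWord true m) = δ • 1 - ((z : Scalar) * (v : Scalar)) •
      ∑ n ∈ Finset.range m, (((asc (gen m) 0 n)⁻¹ * (desc (gen m) 0 n)⁻¹ : (Hecke m)ˣ) :
        Hecke m) := by
  have h : ∀ n ≤ m, cls (up m) (meridianWord true n) =
      δ • 1 - ((z : Scalar) * (v : Scalar)) •
        ∑ n ∈ Finset.range n, (((asc (gen m) 0 n)⁻¹ * (desc (gen m) 0 n)⁻¹ : (Hecke m)ˣ) :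
          Hecke m) := by
    intro n
    induction n with
    | zero => intro _; simpa using cls_shift_meridian_zero (m := m) (p := 0) true (by omega)
    | succ n ih =>
      intro hn
      obtain ⟨p, rfl⟩ : ∃ p, m = n + (1 + p) := ⟨m - (n + 1), by omega⟩
      have e := cls_meridian_concat (a := up (n + (1 + p))) (b := up n) (Q := up p)
        (by simp only [up, List.replicate_add]; rfl)
      simp only [List.length_replicate] at e
      rw [← cls_mul (isTangle_passLeft_up _ (by omega)) (isTangle_pass_up _ (by omega)),
        cls_pass _ (by omega), cls_passLeft _ (by omega), ← asc_gen_inv, ← desc_gen_inv,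
        ← Units.val_mul (asc _ _ _)⁻¹] at e
      rw [Finset.sum_range_succ, e, ih (by omega), smul_add, sub_sub]
  exact h m le_rfl

/-! ### The meridian around the closed braids -/

/-- The closure of an invertible element. -/
def trace {m : ℕ} (x : (Hecke m)ˣ) : Annulus := closure (up m) x

theorem trace_mul_comm {m : ℕ} (x y : (Hecke m)ˣ) : trace (x * y) = trace (y * x) := by
  rw [trace, trace, Units.val_mul, Units.val_mul, closure_mul_comm]

theorem A_eq_trace (m : ℕ) : A m = trace (desc (gen m) 0 (m - 1)) := by
  rw [A, trace, desc_gen, ← prod_reverse_range]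
  simp

theorem ABar_eq_trace (m : ℕ) : ABar m = trace (asc (gen m) 0 (m - 1))⁻¹ := by
  rw [ABar, trace, asc_gen_inv, ← prod_reverse_range]
  simp

theorem braidA_eq_trace {m i j : ℕ} (h : i + j + 1 = m) :
    braidA i j = trace (desc (gen m) j i * (asc (gen m) 0 j)⁻¹) := by
  subst h
  rw [braidA, trace, Units.val_mul, asc_gen_inv, desc_gen, ← prod_reverse_range,
    ← prod_reverse_range]
  simp

theorem X_eq_sum (m : ℕ) : X m = ∑ n ∈ Finset.range m, braidA n (m - 1 - n) := by
  rw [X, ← Finset.sum_range_reflect]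
  refine Finset.sum_congr rfl fun j hj => ?_
  rw [Finset.mem_range] at hj
  rw [show m - 1 - (m - 1 - j) = j by omega]

theorem deltaPhi_ABar (m : ℕ) :
    deltaPhi (ABar m) = ((z : Scalar) * ((v⁻¹ : Scalarˣ) : Scalar)) • X m := by
  have e : ABar m = closure (up m) (((asc (gen m) 0 (m - 1))⁻¹ : (Hecke m)ˣ) : Hecke m) :=
    ABar_eq_trace m
  rw [deltaPhi, phi, e, meridianMap_closure]
  simp only [List.length_replicate]
  rw [cls_meridian_false, add_mul, map_add, smul_mul_assoc, one_mul, map_smul, add_sub_cancel_left,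
    smul_mul_assoc, map_smul, RectSkein.sum_mul, map_sum, X_eq_sum]
  congr 1
  refine Finset.sum_congr rfl fun n hn => ?_
  rw [Finset.mem_range] at hn
  have hm : n + (m - 1 - n) + 1 = m := by omega
  generalize m - 1 - n = p at hm
  subst hm
  -- The cycle splits at strand `p`. Its right part supplies the conjugating inverse for
  -- `trace_asc_desc`, and its left part is `Z`, which commutes with all generators of index above
  -- `p`.
  rw [← Units.val_mul, braidA_eq_trace rfl, show n + p + 1 - 1 = p + n by omega, asc_add,
    mul_inv_rev, ← mul_assoc, zero_add]
  refine (isBraid_gen _).trace_asc_desc trace_mul_comm (by omega) fun k h1 h2 => ?_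
  refine (Commute.symm ?_).inv_left
  exact commute_asc fun l h3 h4 => (isBraid_gen _).commute (by omega) (by omega) (by omega)

theorem deltaPhiBar_A (m : ℕ) :
    deltaPhiBar (A m) = -(((z : Scalar) * (v : Scalar)) • X m) := by
  have e : A m = closure (up m) ((desc (gen m) 0 (m - 1) : (Hecke m)ˣ) : Hecke m) :=
    A_eq_trace m
  rw [deltaPhiBar, phiBar, e, meridianMap_closure]
  simp only [List.length_replicate]
  rw [cls_meridian_true, sub_mul, map_sub, smul_mul_assoc, one_mul, map_smul, sub_sub_cancel_left,
    smul_mul_assoc, map_smul, RectSkein.sum_mul, map_sum, X]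
  congr 2
  refine Finset.sum_congr rfl fun n hn => ?_
  rw [Finset.mem_range] at hn
  have hm : m - 1 - n + n + 1 = m := by omega
  generalize m - 1 - n = p at hm
  subst hm
  rw [← Units.val_mul, braidA_eq_trace rfl, show p + n + 1 - 1 = n + p by omega, desc_add,
    zero_add]
  change trace _ = _
  -- Cyclicity brings `desc 0 n` to the front, where it conjugates `(asc 0 n)⁻¹`; the remaining
  -- factor `Z = desc n p` commutes with the generators of index below `n - 1`.
  rw [← mul_assoc, trace_mul_comm, ← mul_assoc, ← mul_assoc,
    (isBraid_gen _).trace_desc_asc_inv trace_mul_comm (by omega), trace_mul_comm]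
  intro k hk
  exact (commute_desc fun l h3 h4 =>
    (isBraid_gen _).commute (by omega) (by omega) (by omega)).symm

theorem v_smul_deltaPhi_ABar (m : ℕ) : (v : Scalar) • deltaPhi (ABar m) = brace 1 • X m := by
  rw [deltaPhi_ABar, smul_smul, mul_left_comm, Units.mul_inv, mul_one]
  rfl

theorem v_smul_deltaPhiBar_A (m : ℕ) :
    -(((v⁻¹ : Scalarˣ) : Scalar) • deltaPhiBar (A m)) = brace 1 • X m := by
  rw [deltaPhiBar_A, smul_neg, neg_neg, smul_smul, mul_left_comm, Units.inv_mul, mul_one]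
  rfl

/-! ### Products of closed braids -/

/-- Juxtaposition of closures is the closure of a product in one Hecke algebra. The free `m` makes
factors in either order comparable in the same algebra. -/
theorem closure_mul_closure_up {i j m : ℕ} (h : i + j = m) {w u : Word}
    (hw : IsTangle (up i) w (up i)) (hu : IsTangle (up j) u (up j)) :
    closure (up i) (cls (up i) w) * closure (up j) (cls (up j) u) =
      closure (up m) (cls (up m) w * cls (up m) (shift i u)) := by
  subst h
  have e : up (i + j) = up i ++ up j := List.replicate_add _ _ _
  have h1 := hw.padRight (up j)
  have h2 := hu.padLeft (up i)
  rw [closure_mul_closure hw hu]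
  rw [← e] at h1 h2 ⊢
  simp only [List.length_replicate] at h2 ⊢
  rw [cls_mul h1 h2]

theorem A_succ (i : ℕ) : A (i + 1) = closure (up (i + 1)) (cls (up (i + 1)) (passLeft true 0 i)) := by
  rw [A_eq_trace, trace, desc_gen, cls_passLeft _ (by omega), Nat.add_sub_cancel]

theorem ABar_succ (i : ℕ) :
    ABar (i + 1) = closure (up (i + 1)) (cls (up (i + 1)) (passLeft false 0 i)) := by
  rw [ABar_eq_trace, trace, asc_gen_inv, cls_passLeft _ (by omega), Nat.add_sub_cancel]

theorem A_mul_A_eq_trace {i j m : ℕ} (h : i + 1 + (j + 1) = m) :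
    A (i + 1) * A (j + 1) = trace (desc (gen m) 0 i * desc (gen m) (i + 1) j) := by
  rw [A_succ, A_succ, closure_mul_closure_up h (isTangle_passLeft_up _ (by omega))
    (isTangle_passLeft_up _ (by omega)), shift_passLeft, cls_passLeft _ (by omega),
    cls_passLeft _ (by omega), trace, Units.val_mul, desc_gen, desc_gen]

theorem A_mul_A_comm (i j : ℕ) : A (i + 1) * A (j + 1) = A (j + 1) * A (i + 1) := by
  rw [A_mul_A_eq_trace rfl, A_mul_A_eq_trace (m := i + 1 + (j + 1)) (by omega)]
  exact (isBraid_gen _).trace_desc_mul_desc trace_mul_comm (by omega)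

theorem ABar_mul_A {i j m : ℕ} (h : j + 1 + (i + 1) = m) :
    ABar (j + 1) * A (i + 1) = closure (up m)
      (desc (sigma m true) (j + 1) i * desc (sigma m false) 0 j) := by
  rw [ABar_succ, A_succ, closure_mul_closure_up h (isTangle_passLeft_up _ (by omega))
    (isTangle_passLeft_up _ (by omega)), shift_passLeft, cls_passLeft _ (by omega),
    cls_passLeft _ (by omega), closure_mul_comm]

/-- The skein relation at the lowest positive crossing: switching makes it the highest negative one,
and smoothing disconnects the closed braid into two cycles. -/
theorem braidA_succ_left (i j : ℕ) :
    braidA (i + 1) j = braidA i (j + 1) + (z : Scalar) • (ABar (j + 1) * A (i + 1)) := by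
  have e : ∀ {i j m : ℕ}, i + j + 1 = m → braidA i j =
      closure (up m) (desc (sigma m true) j i * desc (sigma m false) 0 j) := by
    intro i j m h
    rw [braidA_eq_trace h, trace, Units.val_mul, asc_gen_inv, desc_gen]
  rw [e (m := i + j + 2) (by omega), e (m := i + j + 2) (by omega),
    ABar_mul_A (m := i + j + 2) (by omega), ← map_smul, ← map_add, desc_succ,
    sigma_sub_sigma (by omega), desc_succ', zero_add, mul_add, add_mul, mul_assoc, mul_smul_comm,
    mul_one, smul_mul_assoc]

theorem braidA_zero_right (i : ℕ) : braidA i 0 = A (i + 1) := by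
  rw [braidA_eq_trace rfl, A_eq_trace]; simp

theorem braidA_zero_left (j : ℕ) : braidA 0 j = ABar (j + 1) := by
  rw [braidA_eq_trace (m := j + 1) (by omega), ABar_eq_trace]; simp

/-- Telescopes `braidA_succ_left` down to `j = 0`. The sum depends on `i` only through `i + j`. -/
theorem braidA_eq_sub (i j : ℕ) :
    braidA i j = A (i + j + 1) - (z : Scalar) •
      ∑ k ∈ Finset.range j, ABar (k + 1) * A (i + j - k) := by
  induction j generalizing i with
  | zero => simp [braidA_zero_right]
  | succ j ih =>
    have e := braidA_succ_left i j
    rw [ih, ← sub_eq_iff_eq_add] at e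
    rw [← e, Finset.sum_range_succ, smul_add, sub_add_eq_sub_sub, add_right_comm i 1 j,
      ← add_assoc, show i + j + 1 - j = i + 1 by omega]

/-! ### The complete symmetric functions -/

theorem quasiIdem_eq_sym (m : ℕ) : quasiIdem m = sym (sigma m true) 0 m := by
  rw [← sum_perm_eq_sym, quasiIdem]
  simp [permBraid]

/-- Uniqueness of `alpha m` is not needed: both scalars satisfy `a a = α a`, so applying `symScalar
m` to `α⁻¹ a` gives `α⁻¹ (a a) = a`. -/
theorem symScalar_smul_hComplete (m : ℕ) :
    symScalar m • hComplete m = closure (up m) (quasiIdem m) := by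
  have h : quasiIdem m * quasiIdem m = symScalar m • quasiIdem m := by
    rw [quasiIdem_eq_sym]
    exact (isHecke_sigma m).sym_mul_sym (by omega)
  have hα : quasiIdem m * quasiIdem m = (alpha m : Scalar) • quasiIdem m :=
    Classical.epsilon_spec (p := fun α : Scalarˣ =>
      quasiIdem m * quasiIdem m = (α : Scalar) • quasiIdem m) ⟨(isUnit_symScalar m).unit, h⟩
  rw [hComplete, ← map_smul, smul_comm, ← h, hα, smul_smul, Units.inv_mul, one_smul]

theorem hComplete_zero : hComplete 0 = 1 := by
  have h := symScalar_smul_hComplete 0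
  rw [quasiIdem_eq_sym] at h
  simp only [symScalar, Finset.range_zero, Finset.prod_empty, one_smul, sym] at h
  rw [h, ← cls_nil, closure_cls (a := up 0) (w := []) rfl]
  rfl

theorem mem_permWord_lt {m : ℕ} {π : Equiv.Perm (Fin m)} {k : ℕ} (hk : k ∈ permWord π) :
    k + 1 < m := by
  simp only [permWord, List.mem_flatMap, List.mem_map, List.mem_reverse, List.mem_range] at hk
  obtain ⟨i, -, c, hc, rfl⟩ := hk
  have h : code π i ≤ (Finset.Ioi i).card :=
    Finset.card_le_card fun j hj => by
      rw [Finset.mem_filter] at hj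
      exact Finset.mem_Ioi.2 hj.2.1
  rw [Fin.card_Ioi] at h
  omega

/-- The two factors occupy disjoint blocks of strands. Expanding the symmetrizer over permutations
reduces this to closures of words. -/
theorem closure_desc_mul_sym {i j m : ℕ} (h : i + 1 + j = m) :
    closure (up m) (desc (sigma m true) 0 i * sym (sigma m true) (i + 1) j) =
      A (i + 1) * closure (up j) (quasiIdem j) := by
  rw [← sum_perm_eq_sym, quasiIdem, RectSkein.mul_sum, map_sum, map_sum, Annulus.mul_sum]
  refine Finset.sum_congr rfl fun π _ => ?_
  have hπ : ∀ k ∈ permWord π, k + 1 < j := fun k hk => mem_permWord_lt hk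
  have t : IsTangle (up j) ((permWord π).map fun k => (k, Gen.cross true)) (up j) :=
    isTangle_braid (by simpa using hπ)
  have e1 : permBraid π = cls (up j) ((permWord π).map fun k => (k, Gen.cross true)) :=
    (cls_braid true hπ).symm
  have e2 : ((permWord π).map fun k => sigma m true (i + 1 + k)).prod =
      cls (up m) (shift (i + 1) ((permWord π).map fun k => (k, Gen.cross true))) := by
    have := cls_braid (m := m) true (L := (permWord π).map (i + 1 + ·)) (by
      intro k hk
      obtain ⟨l, hl, rfl⟩ := List.mem_map.1 hk
      have := hπ l hl
      omega)
    simpa [shift, Function.comp_def] using this.symm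
  rw [mul_smul_comm, map_smul, map_smul, mul_smul_comm, e1, e2, A_succ,
    closure_mul_closure_up h (isTangle_passLeft_up _ (by omega)) t, cls_passLeft _ (by omega),
    Units.val_pow_eq_pow_val]

/-- In the expansion of the symmetrizer along strand `i`, the leading term separates from the cycle.
Every other term lengthens the cycle by one strand, and all these terms have proportional closures.
-/
theorem closure_sym_succ {i j m : ℕ} (h : i + 1 + j = m) :
    closure (up m) (desc (sigma m true) 0 i * sym (sigma m true) i (j + 1)) =
      A (i + 1) * closure (up j) (quasiIdem j) + ((s : Scalar) * qNum j) •
        closure (up m) (desc (sigma m true) 0 (i + 1) * sym (sigma m true) (i + 1) j) := by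
  have hf := isHecke_sigma m
  set f := sigma m true with hfdef
  set E := sym f (i + 1) j with hE
  have cE : ∀ k, i + 1 ≤ k → k + 1 < i + 1 + j → E * f k = (s : Scalar) • E := fun k h1 h2 =>
    hf.sym_mul (by omega) h1 h2
  have cE' : ∀ c < j, E * desc f (i + 1) c = (s : Scalar) ^ c • E := by
    intro c
    induction c with
    | zero => simp
    | succ c ih =>
      intro hc
      rw [desc_succ', ← mul_assoc, cE _ (by omega) (by omega), smul_mul_assoc, ih (by omega),
        smul_smul, pow_succ']
  have cD : Commute E (desc f 0 i) := (commute_sym fun k h1 h2 => Commute.symm <|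
    commute_desc fun l h3 h4 => hf.commute (by omega) (by omega) (by omega)).symm
  -- Only the factor `f i` joins the cycle. The rest, `desc f (i + 1) c`, goes around the trace and
  -- is absorbed by `E` as `s ^ c`; with the coefficient `s ^ (c + 1)` this adds up to `s * qNum j`.
  have term : ∀ c < j, closure (up m) (desc f 0 i * (desc f i (c + 1) * E)) =
      (s : Scalar) ^ c • closure (up m) (desc f 0 (i + 1) * E) := by
    intro c hc
    have c1 : Commute (desc f 0 i) (desc f (i + 1) c) :=
      commute_desc fun k h1 h2 => (commute_desc fun l h3 h4 =>
        hf.commute (by omega) (by omega) (by omega)).symm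
    calc closure (up m) (desc f 0 i * (desc f i (c + 1) * E))
        = closure (up m) (desc f (i + 1) c * (desc f 0 i * f i * E)) := by
          rw [desc_succ, ← mul_assoc, ← mul_assoc, c1.eq]; simp only [mul_assoc]
      _ = (s : Scalar) ^ c • closure (up m) (desc f 0 i * (f i * E)) := by
          rw [closure_mul_comm, mul_assoc _ E, cE' c hc, mul_smul_comm, map_smul, mul_assoc]
      _ = (s : Scalar) ^ c • closure (up m) (desc f 0 (i + 1) * E) := by
          rw [closure_mul_comm, mul_assoc, cD.eq, ← mul_assoc, desc_succ', zero_add]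
  rw [sym, ← hE, RectSkein.sum_mul, RectSkein.mul_sum, map_sum, Finset.sum_range_succ', add_comm]
  congr 1
  · rw [← closure_desc_mul_sym h]
    simp [hE, hfdef]
  · rw [qNum, Finset.mul_sum, Finset.sum_smul]
    refine Finset.sum_congr rfl fun c hc => ?_
    rw [Finset.mem_range] at hc
    rw [smul_mul_assoc, mul_smul_comm, map_smul, term c hc, smul_smul]
    congr 1
    ring

/-- The closure of a cycle on `i + 1` strands that shares its last strand with the normalized
symmetrizer on `j` strands. -/
def hook (i j : ℕ) : Annulus :=
  Ring.inverse (symScalar j) •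
    closure (up (i + j)) (desc (sigma (i + j) true) 0 i * sym (sigma (i + j) true) i j)

theorem symScalar_smul_hook {i j m : ℕ} (h : i + j = m) : symScalar j • hook i j =
    closure (up m) (desc (sigma m true) 0 i * sym (sigma m true) i j) := by
  subst h
  rw [hook, smul_smul, Ring.mul_inverse_cancel _ (isUnit_symScalar j), one_smul]

theorem symScalar_succ (n : ℕ) : symScalar (n + 1) = qNum (n + 1) * symScalar n := by
  rw [symScalar, Finset.prod_range_succ, mul_comm]; rfl

theorem qNum_smul_hook_succ (i j : ℕ) : qNum (j + 1) • hook i (j + 1) =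
    A (i + 1) * hComplete j + ((s : Scalar) * qNum j) • hook (i + 1) j := by
  apply (isUnit_symScalar j).smul_left_cancel.1
  have e := closure_sym_succ (i := i) (j := j) rfl
  rw [← symScalar_smul_hook (by omega), ← symScalar_smul_hook rfl, ← symScalar_smul_hComplete,
    symScalar_succ] at e
  rw [smul_smul, mul_comm, e, smul_add, mul_smul_comm, smul_comm (symScalar j)]

theorem qNum_smul_hook (i j : ℕ) : qNum j • hook i j =
    ∑ r ∈ Finset.range j, (s : Scalar) ^ r • (A (i + r + 1) * hComplete (j - 1 - r)) := by
  induction j generalizing i with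
  | zero => simp [qNum]
  | succ j ih =>
    rw [qNum_smul_hook_succ, mul_smul, ih, Finset.sum_range_succ', add_comm, Finset.smul_sum]
    congr 1
    · refine Finset.sum_congr rfl fun r _ => ?_
      rw [smul_smul, ← pow_succ', add_right_comm i 1 r, ← add_assoc,
        show j - 1 - r = j + 1 - 1 - (r + 1) by omega]
    · simp

/-- The hooks interpolate: `hook 0 m` is `h_m`, and the recursion transfers strands from the
symmetrizer to the cycle until none are left. -/
theorem qNum_smul_hComplete (m : ℕ) : qNum m • hComplete m =
    ∑ r ∈ Finset.range m, (s : Scalar) ^ r • (A (r + 1) * hComplete (m - 1 - r)) := by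
  have e : hook 0 m = hComplete m := by
    apply (isUnit_symScalar m).smul_left_cancel.1
    rw [symScalar_smul_hook (zero_add m), symScalar_smul_hComplete, quasiIdem_eq_sym, desc_zero,
      one_mul]
  rw [← e, qNum_smul_hook]
  simp only [zero_add]

/-! ### Power sums -/

/-- Newton's relation for sequences in the commutative subalgebra generated by `t`. -/
theorem newton_of_mem_adjoin {R : Type*} [Ring R] [Algebra Scalar R] {t : Set R}
    (ht : ∀ x ∈ t, ∀ y ∈ t, x * y = y * x) {q q' : Scalar} {a b h p : ℕ → R}
    (ha : ∀ n, a n ∈ Algebra.adjoin Scalar t) (hb : ∀ n, b n ∈ Algebra.adjoin Scalar t)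
    (hh : ∀ n, h n ∈ Algebra.adjoin Scalar t) (hp : ∀ n, p n ∈ Algebra.adjoin Scalar t)
    (hh0 : h 0 = 1)
    (hba : ∀ n, ∑ k ∈ Finset.range (n + 1), b k * a (n - k) = if n = 0 then 1 else 0)
    (hha : ∀ n, q ^ n • h n = ∑ k ∈ Finset.range (n + 1), q' ^ (n - k) • (a k * h (n - k)))
    (hph : ∀ n, n • h n = ∑ k ∈ Finset.range (n + 1), p k * h (n - k)) (n : ℕ) :
    (q ^ n - q' ^ n) • p n = ∑ k ∈ Finset.range (n + 1), (n - k) • (b k * a (n - k)) := by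
  -- Generators that commute pairwise make the subalgebra a commutative ring, in which the power
  -- series argument applies.
  let S := Algebra.adjoin Scalar t
  have hS : IsMulCommutative S := Algebra.isMulCommutative_adjoin Scalar ht
  let _ : CommRing S := { S.toRing with mul_comm := hS.is_comm.comm }
  have key := pow_sub_pow_mul_of_newton (S := S) (q := algebraMap Scalar S q)
    (q' := algebraMap Scalar S q') (a := fun n => ⟨a n, ha n⟩) (b := fun n => ⟨b n, hb n⟩)
    (h := fun n => ⟨h n, hh n⟩) (p := fun n => ⟨p n, hp n⟩) (y := _)
    (Subtype.ext hh0)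
    (fun n => by
      rw [Finset.Nat.sum_antidiagonal_eq_sum_range_succ_mk]
      apply Subtype.ext
      have := hba n
      push_cast
      rw [this]
      split_ifs <;> rfl)
    -- This equation is what determines the sequence `y` left open above.
    (fun n => rfl)
    (fun n => by
      rw [Finset.Nat.sum_antidiagonal_eq_sum_range_succ_mk]
      apply Subtype.ext
      have := hha n
      simp only [← map_pow, ← Algebra.smul_def, mul_smul_comm]
      push_cast
      exact this)
    (fun n => by
      rw [Finset.Nat.sum_antidiagonal_eq_sum_range_succ_mk]
      apply Subtype.ext
      have := hph n
      simp only [← nsmul_eq_mul]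
      push_cast
      exact this) n
  rw [Finset.Nat.sum_antidiagonal_eq_sum_range_succ_mk] at key
  have key' := congrArg Subtype.val key
  simp only [← map_pow, ← map_sub, ← Algebra.smul_def, mul_smul_comm, ← nsmul_eq_mul] at key'
  push_cast at key'
  simpa [mul_smul_comm] using key'

/-- The subalgebra generated by the closed braids `A_m`. -/
def closedBraids : Subalgebra Scalar Annulus :=
  Algebra.adjoin Scalar (Set.range fun i => A (i + 1))

theorem A_succ_mem (i : ℕ) : A (i + 1) ∈ closedBraids := Algebra.subset_adjoin ⟨i, rfl⟩

theorem ABar_succ_eq (n : ℕ) : ABar (n + 1) =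
    A (n + 1) - (z : Scalar) • ∑ k ∈ Finset.range n, ABar (k + 1) * A (n - k) := by
  have := braidA_eq_sub 0 n
  rwa [braidA_zero_left, zero_add] at this

theorem ABar_succ_mem (n : ℕ) : ABar (n + 1) ∈ closedBraids := by
  induction n using Nat.strong_induction_on with
  | _ n ih =>
    rw [ABar_succ_eq]
    refine sub_mem (A_succ_mem n) (Subalgebra.smul_mem _ (sum_mem fun k hk => ?_) _)
    rw [Finset.mem_range] at hk
    obtain ⟨l, hl⟩ : ∃ l, n - k = l + 1 := ⟨n - k - 1, by omega⟩
    rw [hl]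
    exact mul_mem (ih k hk) (A_succ_mem l)

/-- Since `qNum (n + 1)` is invertible, the expansion of `h_{n+1}` in cycles determines it
recursively. -/
theorem hComplete_mem (n : ℕ) : hComplete n ∈ closedBraids := by
  induction n using Nat.strong_induction_on with
  | _ n ih =>
    cases n with
    | zero => rw [hComplete_zero]; exact one_mem _
    | succ n =>
      obtain ⟨u, hu⟩ := isUnit_qNum n
      have e : hComplete (n + 1) = ((u⁻¹ : Scalarˣ) : Scalar) • qNum (n + 1) • hComplete (n + 1) := by
        rw [← hu, smul_smul, Units.inv_mul, one_smul]
      rw [e, qNum_smul_hComplete]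
      refine Subalgebra.smul_mem _ (sum_mem fun k hk => Subalgebra.smul_mem _ ?_ _) _
      exact mul_mem (A_succ_mem k) (ih _ (by omega))

theorem powerSum_mem (n : ℕ) : powerSum n ∈ closedBraids := by
  induction n using Nat.strong_induction_on with
  | _ n ih =>
    rw [powerSum]
    exact sub_mem (nsmul_mem (hComplete_mem n) n)
      (sum_mem fun r _ => mul_mem (ih r r.2) (hComplete_mem _))

theorem nsmul_hComplete (n : ℕ) :
    n • hComplete n = ∑ k ∈ Finset.range (n + 1), powerSum k * hComplete (n - k) := by
  rw [Finset.sum_range_succ, Nat.sub_self, hComplete_zero, mul_one]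
  conv_rhs => rw [powerSum]
  rw [← Fin.sum_univ_eq_sum_range fun k => powerSum k * hComplete (n - k), add_sub_cancel]

/-- The coefficients of `1 + c ∑ x_n t ^ n`. -/
def unitCoeff {R : Type*} [Ring R] [Algebra Scalar R] (c : Scalar) (x : ℕ → R) (n : ℕ) : R :=
  if n = 0 then 1 else c • x n

/-! ### Recursions as identities of generating series -/

section Coefficients

variable {R : Type*} [Ring R] [Algebra Scalar R]

@[simp] theorem unitCoeff_zero (c : Scalar) (x : ℕ → R) : unitCoeff c x 0 = 1 := rfl

@[simp] theorem unitCoeff_succ (c : Scalar) (x : ℕ → R) (n : ℕ) :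
    unitCoeff c x (n + 1) = c • x (n + 1) := rfl

theorem unitCoeff_mem {S : Subalgebra Scalar R} {c : Scalar} {x : ℕ → R}
    (h : ∀ n, x (n + 1) ∈ S) (n : ℕ) : unitCoeff c x n ∈ S := by
  cases n with
  | zero => exact one_mem _
  | succ n => exact Subalgebra.smul_mem _ (h n) _

theorem unitCoeff_neg_mul_unitCoeff {c : Scalar} {x y : ℕ → R} {n k : ℕ} (h : k < n) :
    unitCoeff (-c) y (k + 1) * unitCoeff c x (n - k) = -(c • c • (y (k + 1) * x (n - k))) := by
  obtain ⟨l, hl⟩ : ∃ l, n - k = l + 1 := ⟨n - k - 1, by omega⟩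
  rw [hl, unitCoeff_succ, unitCoeff_succ, neg_smul, neg_mul, smul_mul_assoc, mul_smul_comm]

/-- The recursion is the coefficient form of `(1 - c ∑ y_n t^n) (1 + c ∑ x_n t^n) = 1`. -/
theorem sum_unitCoeff_mul_unitCoeff {c : Scalar} {x y : ℕ → R}
    (h : ∀ n, y (n + 1) = x (n + 1) - c • ∑ k ∈ Finset.range n, y (k + 1) * x (n - k)) (n : ℕ) :
    ∑ k ∈ Finset.range (n + 1), unitCoeff (-c) y k * unitCoeff c x (n - k) =
      if n = 0 then 1 else 0 := by
  cases n with
  | zero => simp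
  | succ n =>
    have e : ∑ k ∈ Finset.range n, unitCoeff (-c) y (k + 1) * unitCoeff c x (n + 1 - (k + 1)) =
        -(c • c • ∑ k ∈ Finset.range n, y (k + 1) * x (n - k)) := by
      rw [Finset.smul_sum, Finset.smul_sum, ← Finset.sum_neg_distrib]
      refine Finset.sum_congr rfl fun k hk => ?_
      rw [Nat.add_sub_add_right, unitCoeff_neg_mul_unitCoeff (Finset.mem_range.1 hk)]
    rw [Finset.sum_range_succ, Finset.sum_range_succ', Nat.sub_self, Nat.sub_zero,
      if_neg (by omega), e, unitCoeff_succ, unitCoeff_succ, h, unitCoeff_zero, unitCoeff_zero,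
      neg_smul, smul_sub]
    simp only [one_mul, mul_one]
    abel

/-- Exchanging the sums, `f k` occurs once for each `j` with `k < j ≤ n`. The multiplicities `n - k`
are the weights that the derivative of `A(t)` produces. -/
theorem sum_sub_smul_sum (c : Scalar) (x : R) (f : ℕ → R) (n : ℕ) :
    ∑ j ∈ Finset.range (n + 1), (x - c • ∑ k ∈ Finset.range j, f k) =
      (n + 1) • x - c • ∑ k ∈ Finset.range n, (n - k) • f k := by
  have e : ∑ j ∈ Finset.range (n + 1), ∑ k ∈ Finset.range j, f k =
      ∑ k ∈ Finset.range n, (n - k) • f k := by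
    induction n with
    | zero => simp
    | succ n ih =>
      rw [Finset.sum_range_succ, ih, Finset.sum_range_succ, Finset.sum_range_succ, ← add_assoc,
        ← Finset.sum_add_distrib]
      congr 1
      · refine Finset.sum_congr rfl fun k hk => ?_
        rw [Finset.mem_range] at hk
        rw [show n + 1 - k = n - k + 1 by omega, succ_nsmul]
      · simp
  rw [Finset.sum_sub_distrib, ← Finset.smul_sum, e, Finset.sum_const, Finset.card_range]

/-- The coefficient of `t ^ (n + 1)` in `B · t A'`, in the shape in which `X_succ` presents `X (n +
1)`. The last summand has weight `0`. -/
theorem sum_nsmul_unitCoeff (c : Scalar) (x y : ℕ → R) (n : ℕ) :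
    ∑ k ∈ Finset.range (n + 2), (n + 1 - k) • (unitCoeff (-c) y k * unitCoeff c x (n + 1 - k)) =
      c • ((n + 1) • x (n + 1) - c • ∑ k ∈ Finset.range n, (n - k) • (y (k + 1) * x (n - k))) := by
  have e : ∑ k ∈ Finset.range n, (n + 1 - (k + 1)) •
      (unitCoeff (-c) y (k + 1) * unitCoeff c x (n + 1 - (k + 1))) =
        -(c • c • ∑ k ∈ Finset.range n, (n - k) • (y (k + 1) * x (n - k))) := by
    rw [Finset.smul_sum, Finset.smul_sum, ← Finset.sum_neg_distrib]
    refine Finset.sum_congr rfl fun k hk => ?_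
    rw [Nat.add_sub_add_right, unitCoeff_neg_mul_unitCoeff (Finset.mem_range.1 hk), smul_neg,
      smul_comm (n - k) c, smul_comm (n - k) c]
  rw [Finset.sum_range_succ, Finset.sum_range_succ', Nat.sub_self, Nat.sub_zero, e, unitCoeff_zero,
    unitCoeff_succ, one_mul, zero_smul, smul_sub, smul_comm c (n + 1)]
  abel

/-- The coefficient form of `H(st) = A(t) H(s⁻¹t)`. The hypothesis supplies the terms with `k > 0`
through `s^n - s^(-n) = z s^(-(n-1)) (1 + s² + ⋯ + s^(2(n-1)))`, and `k = 0` supplies `s^(-n) h_n`.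
-/
theorem pow_smul_eq_sum {x h : ℕ → R}
    (hx : ∀ n, qNum n • h n = ∑ r ∈ Finset.range n, (s : Scalar) ^ r • (x (r + 1) * h (n - 1 - r)))
    (n : ℕ) : (s : Scalar) ^ n • h n = ∑ k ∈ Finset.range (n + 1),
      ((s⁻¹ : Scalarˣ) : Scalar) ^ (n - k) • (unitCoeff (z : Scalar) x k * h (n - k)) := by
  cases n with
  | zero => simp
  | succ n =>
    have hs : (s : Scalar) * ((s⁻¹ : Scalarˣ) : Scalar) = 1 := Units.mul_inv _
    have hs' : ((s⁻¹ : Scalarˣ) : Scalar) * (s : Scalar) = 1 := Units.inv_mul _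
    have e1 : (s : Scalar) ^ (n + 1) = ((s⁻¹ : Scalarˣ) : Scalar) ^ (n + 1) +
        (z : Scalar) * ((s⁻¹ : Scalarˣ) : Scalar) ^ n * qNum (n + 1) := by
      rw [mul_right_comm, z_mul_qNum, ← brace_mul_pow, brace_eq, pow_succ, pow_succ]
      have e : (s : Scalar) ^ n * ((s⁻¹ : Scalarˣ) : Scalar) ^ n = 1 := by
        rw [← mul_pow, hs, one_pow]
      linear_combination (-((s : Scalar) ^ n * (s : Scalar) - ((s⁻¹ : Scalarˣ) : Scalar) ^ n *
        ((s⁻¹ : Scalarˣ) : Scalar))) * ((s : Scalar) ^ n * ((s⁻¹ : Scalarˣ) : Scalar) ^ n * hs' + e)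
    have e2 : ∀ r ≤ n, ((s⁻¹ : Scalarˣ) : Scalar) ^ n * (s : Scalar) ^ r =
        ((s⁻¹ : Scalarˣ) : Scalar) ^ (n - r) := by
      intro r hr
      obtain ⟨d, rfl⟩ := Nat.exists_eq_add_of_le hr
      rw [Nat.add_sub_cancel_left, pow_add, mul_right_comm, ← mul_pow, hs', one_pow, one_mul]
    rw [Finset.sum_range_succ', Nat.sub_zero, unitCoeff_zero, one_mul, e1, add_smul, add_comm,
      mul_smul, hx, Finset.smul_sum]
    congr 1
    refine Finset.sum_congr rfl fun r hr => ?_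
    rw [Finset.mem_range] at hr
    rw [smul_smul, mul_assoc, e2 r (by omega), unitCoeff_succ, smul_mul_assoc, smul_smul,
      Nat.add_sub_cancel, Nat.add_sub_add_right, mul_comm]

end Coefficients

theorem X_succ (n : ℕ) : X (n + 1) = (n + 1) • A (n + 1) -
    (z : Scalar) • ∑ k ∈ Finset.range n, (n - k) • (ABar (k + 1) * A (n - k)) := by
  refine Eq.trans (Finset.sum_congr rfl fun j hj => ?_)
    (sum_sub_smul_sum (z : Scalar) (A (n + 1)) (fun k => ABar (k + 1) * A (n - k)) n)
  rw [Finset.mem_range] at hj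
  rw [braidA_eq_sub, show n + 1 - 1 - j + j = n by omega]

/-- Newton's relation with `q = s` and `q' = s⁻¹`, so that `q ^ n - q' ^ n` is `{n}`; the series `A`
and `B` are mutually inverse by `ABar_succ_eq`. -/
theorem brace_smul_powerSum (n : ℕ) :
    brace (n + 1) • powerSum (n + 1) = brace 1 • X (n + 1) := by
  have e := newton_of_mem_adjoin (t := Set.range fun i => A (i + 1))
    (by rintro _ ⟨i, rfl⟩ _ ⟨j, rfl⟩; exact A_mul_A_comm i j)
    (unitCoeff_mem A_succ_mem) (unitCoeff_mem ABar_succ_mem) hComplete_mem powerSum_mem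
    hComplete_zero (sum_unitCoeff_mul_unitCoeff ABar_succ_eq)
    (pow_smul_eq_sum qNum_smul_hComplete) nsmul_hComplete (n + 1)
  rw [brace_eq, e, sum_nsmul_unitCoeff, X_succ]
  -- `z` is by definition the unit with value `brace 1`.
  rfl

end

end HomflySkein

theorem theorem5p2 (m : ℕ) (hm : 1 ≤ m) :
    HomflySkein.brace 1 • HomflySkein.X m =
        (HomflySkein.v : HomflySkein.Scalar) • HomflySkein.deltaPhi (HomflySkein.ABar m) ∧
      HomflySkein.brace 1 • HomflySkein.X m =
        -(((HomflySkein.v⁻¹ : HomflySkein.Scalarˣ) : HomflySkein.Scalar) •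
          HomflySkein.deltaPhiBar (HomflySkein.A m)) ∧
      HomflySkein.brace m • HomflySkein.powerSum m =
        (HomflySkein.v : HomflySkein.Scalar) • HomflySkein.deltaPhi (HomflySkein.ABar m) ∧
      HomflySkein.brace m • HomflySkein.powerSum m =
        -(((HomflySkein.v⁻¹ : HomflySkein.Scalarˣ) : HomflySkein.Scalar) •
          HomflySkein.deltaPhiBar (HomflySkein.A m)) := by
  obtain ⟨n, rfl⟩ := Nat.exists_eq_add_of_le' hm
  rw [HomflySkein.brace_smul_powerSum, HomflySkein.v_smul_deltaPhi_ABar,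
    HomflySkein.v_smul_deltaPhiBar_A]
  exact ⟨rfl, rfl, rfl, rfl⟩
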